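/- **Setting.** Fix finite sets of constructor names $C$, destructor names $D$ and priorities $p\in\mathbb N$ (odd for constructors, even for records and destructors). The domain $\mathcal V$ of values consists of the finite or infinite trees $$v ::= \bot \mid C^p v \mid \{D_1=v_1;\dots;D_k=v_k\}^p ,$$ with $u\le v$ if $v$ is obtained from $u$ by replacing some leaves $\bot$ by values. A value is *total* if it has no leaf $\bot$ and on each of its infinite branches the greatest priority occurring infinitely often is even. Let $\mathcal A$ be the Smyth power domain of $\mathcal V$ with the empty sum $\mathbf 0$ (the error) added as greatest element: its elements are finitely generated sums of values, ordered by reverse inclusion of the upper sets they generate. An element of $\mathcal A$ is total if all its summands are, and a function is total if it sends total elements to total elements. Let $✠:\mathcal A\to\mathcal A$ be defined by $✠(\mathbf 0)=\mathbf 0$ and $✠(v)=\bot$ for $v\neq\mathbf 0$. Terms are $t ::= C^p t \mid \{D_1=t_1;\dots;D_k=t_k\}^p \mid (C^p)^- t\mid D^p t\mid x\mid ✠\{t_1,\dots,t_n\}\mid f\,t\mid g\,t\mid \mathbf 0$, where $x$ is a formal parameter, $f$ is the function being defined and $g$ ranges over the other function names. They are interpreted as functions $\mathcal A\to\mathcal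 A$ in the evident way: $(C^p)^-$ removes the constructor $C^p$, $D^p$ projects on the field $D$, both send $\bot$ to $\bot$ and values of the wrong shape to $\mathbf 0$, and $✠\{t_1,\dots,t_n\}$ has value $\mathbf 0$ if the argument or the value of some $t_i$ is $\mathbf 0$, and $\bot$ otherwise. Write $s(✠)$ for the interpretation of $s$ when $f$ is interpreted by $✠$. Types are inductive (constructors with argument types, one odd priority) or coinductive (destructors with result types, one even priority), possibly mutually nested, and $[\![A]\!]\subseteq\mathcal V$ is the domain of values of type $A$ (types being read coinductively). Let $f:A\to B$ be given by a well-typed recursive definition with clauses $f\,p=u$, where $p$ is a linear pattern and $u$ is built from the variables of $p$, constructors, records, destructors, $f$ and previously defined functions $g$, every total argument being matched by some clause. An environment $\rho$ assigns to each $g:A_g\to B_g$ a continuous function $[\![A_g]\!]\to[\![B_g]\!]$; it is total if all these functions are total. The semantics $[\![f]\!]_\rho:[\![A]\!]\to[\![B]\!]$ is $\bigsqcup_n\Theta_f^n(\bot)$, where $\Theta_f(h)(v)$ is the value of $u$, for the first clause $f\,p=u$ such that $p$ matches $v$, with $f$ interpreted by $h$ and the variables of $p$ by the corresponding parts of $v$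 (and is $\bot$ as long as $v$ is not defined enough to select a clause). Let $T_f=\sum_{f\,p=u}u[\sigma_p]$, where $\sigma_p$ sends each variable of $p$ to the term, built from $x$ with the operations $(C^p)^-$ and $D^p$, that extracts it from the argument $x$. The call-graph $G(T_f)$ is the sum of the terms $\beta^{✠}f\,(t^{✠})$, one for each occurrence $f\,t$ of $f$ in a summand of $T_f$, where $\beta$ is the branch leading to this occurrence, with records restricted to one field, and where $(\cdot)^{✠}$ replaces all function names by $✠$. An infinite path of a sum $T$ of terms is a sequence $(s_k)_{k\ge0}$ of terms, each containing $f$, with $s_0=f\,x$, such that $s_{k+1}$ is obtained from $s_k$ by replacing each occurrence $f\,t$ by $r[x:=t]$ for some summand $r$ of $T$ (chosen independently for each occurrence). It is total if the function $\bigsqcup_k s_k(✠):\mathcal A\to\mathcal A$ is total. **Statement.** If every infinite path of $G(T_f)$ is total, then $[\![f]\!]_\rho:[\![A]\!]\to[\![B]\!]$ is total for every total environment $\rho$. -/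

import Mathlib

/-- Constructor and destructor names, and the priorities in use; all three sets are finite. -/
structure Signature where
  Con : Type
  Des : Type
  Prio : Finset ℕ
  [finite_con : Finite Con]
  [finite_des : Finite Des]

namespace SizeChange

open Set Filter

/-! ## Values -/

/-- Priorities of constructors (of inductive types) are odd. -/
abbrev OddPrio (S : Signature) : Type := {p : ℕ // p ∈ S.Prio ∧ Odd p}

/-- Priorities of records and destructors (of coinductive types) are even. -/
abbrev EvenPrio (S : Signature) : Type := {p : ℕ // p ∈ S.Prio ∧ Even p}

/-- The label of a node of a value other than `⊥`: a constructor `C^p`, or a record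
`{…}^p` together with its set of fields. -/
inductive Node (S : Signature) : Type
  | con (c : S.Con) (p : OddPrio S) : Node S
  | record (ds : Set S.Des) (p : EvenPrio S) : Node S

/-- A step from a node to one of its children: `none` goes below a constructor, and `some d` goes
into the field `d` of a record. -/
abbrev Step (S : Signature) : Type := Option S.Des

/-- The steps that lead to a child of a node with a given label. -/
def Node.Allows {S : Signature} : Node S → Step S → Prop
  | .con _ _, s => s = none
  | .record ds _, s => ∃ d ∈ ds, s = some d

def Node.prio {S : Signature} : Node S → ℕ
  | .con _ p => p.1
  | .record _ p => p.1

/-- Values: the possibly infinite trees given coinductively by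
`v ::= ⊥ | C^p v | {D₁ = v₁; …; D_k = v_k}^p`.
A tree is given by its label at every address (a list of steps, read from the root). The label is
`none` at the leaves `⊥`, and at the addresses that do not belong to the tree. -/
@[ext]
structure Val (S : Signature) : Type where
  node : List (Step S) → Option (Node S)
  wf : ∀ a s, node (a ++ [s]) ≠ none → ∃ n, node a = some n ∧ n.Allows s

variable {S : Signature}

namespace Val

/-- The order on values: `⊥` is least and the constructions are monotonic, that is, `u ≤ v` when
`v` is obtained by replacing leaves `⊥` of `u` by arbitrary values. -/
instance : PartialOrder (Val S) where
  le u v := ∀ a n, u.node a = some n → v.node a = some n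
  le_refl _ _ _ h := h
  le_trans _ _ _ h₁ h₂ a n h := h₂ a n (h₁ a n h)
  le_antisymm u v h₁ h₂ := by
    ext a n
    exact ⟨h₁ a n, h₂ a n⟩

theorem le_def {u v : Val S} : u ≤ v ↔ ∀ a n, u.node a = some n → v.node a = some n := Iff.rfl

instance : OrderBot (Val S) where
  bot := ⟨fun _ => none, fun _ _ h => absurd rfl h⟩
  bot_le _ _ _ h := by cases h

@[simp] theorem bot_node (a : List (Step S)) : (⊥ : Val S).node a = none := rfl

/-- The label of the root. -/
def head (v : Val S) : Option (Node S) := v.node []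

/-- The child of a value in a given direction (`⊥` if there is none). -/
def sub (s : Step S) (v : Val S) : Val S where
  node a := v.node (s :: a)
  wf a t h := v.wf (s :: a) t h

/-- `C^p v`. -/
def con (c : S.Con) (p : OddPrio S) (v : Val S) : Val S where
  node
    | [] => some (.con c p)
    | none :: a => v.node a
    | some _ :: _ => none
  wf a s h := by
    rcases a with _ | ⟨_ | d, a⟩
    · refine ⟨_, rfl, ?_⟩
      rcases s with _ | d
      · rfl
      · exact absurd rfl h
    · exact v.wf a s h
    · exact absurd rfl h

open Classical in
/-- `{…; d = v d; …}^p`, where `d` ranges over `ds`. -/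
noncomputable def record (ds : Set S.Des) (p : EvenPrio S) (v : ds → Val S) : Val S where
  node
    | [] => some (.record ds p)
    | none :: _ => none
    | some d :: a => if h : d ∈ ds then (v ⟨d, h⟩).node a else none
  wf a s h := by
    rcases a with _ | ⟨_ | d, a⟩
    · refine ⟨_, rfl, ?_⟩
      rcases s with _ | d
      · exact absurd rfl h
      · by_cases hd : d ∈ ds
        · exact ⟨d, hd, rfl⟩
        · exact absurd (dif_neg hd) h
    · exact absurd rfl h
    · by_cases hd : d ∈ ds
      · simp only [List.cons_append, dif_pos hd] at h ⊢
        exact (v ⟨d, hd⟩).wf a s h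
      · exact absurd (dif_neg hd) h

/-- The first `k` steps of an infinite sequence of steps. -/
def prefixOf (b : ℕ → Step S) (k : ℕ) : List (Step S) := (List.range k).map b

/-- The finite address `a` belongs to the tree `v`: it is the address of a node or a leaf `⊥`. -/
def Reachable (v : Val S) (a : List (Step S)) : Prop :=
  a = [] ∨ ∃ a' s n, a = a' ++ [s] ∧ v.node a' = some n ∧ n.Allows s

/-- The infinite sequence `b` of steps is an infinite branch of `v`. -/
def IsBranch (v : Val S) (b : ℕ → Step S) : Prop :=
  ∀ k, ∃ n, v.node (prefixOf b k) = some n ∧ n.Allows (b k)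

/-- The number `p` is the principal priority of the branch `b` of `v`: the greatest priority that
occurs infinitely often on it. -/
def PrincipalPrio (v : Val S) (b : ℕ → Step S) (p : ℕ) : Prop :=
  (∃ᶠ k in atTop, (v.node (prefixOf b k)).map Node.prio = some p) ∧
    ∀ᶠ k in atTop, ∀ q, (v.node (prefixOf b k)).map Node.prio = some q → q ≤ p

/-- A value is total if it has no branch that ends with `⊥` and if all its infinite
branches have an even principal priority. -/
def Total (v : Val S) : Prop :=
  (∀ a, v.Reachable a → v.node a ≠ none) ∧
    ∀ b, v.IsBranch b → ∃ p, v.PrincipalPrio b p ∧ Even p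

/-- Finite values, the compact elements of the domain of values. -/
def IsFinite (v : Val S) : Prop := {a | v.node a ≠ none}.Finite

open Classical in
/-- Values are closed under least upper bounds of chains. -/
noncomputable instance : OmegaCompletePartialOrder (Val S) where
  ωSup c :=
    { node := fun a => if h : ∃ n, ∃ k, (c k).node a = some n then some h.choose else none
      wf := fun a s hs => by
        have h : ∃ n, ∃ k, (c k).node (a ++ [s]) = some n := by
          by_contra h
          exact hs (dif_neg h)
        obtain ⟨n, k, hk⟩ := h
        obtain ⟨m, hm, hms⟩ := (c k).wf a s (by simp [hk])
        have h' : ∃ n, ∃ k, (c k).node a = some n := ⟨m, k, hm⟩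
        refine ⟨m, ?_, hms⟩
        obtain ⟨l, hl⟩ := h'.choose_spec
        rw [dif_pos h']
        have h₁ := c.monotone (le_max_left k l) a _ hm
        have h₂ := c.monotone (le_max_right k l) a _ hl
        exact h₂.symm.trans h₁ }
  le_ωSup c k := fun a n hk => by
    have h : ∃ n, ∃ k, (c k).node a = some n := ⟨n, k, hk⟩
    obtain ⟨l, hl⟩ := h.choose_spec
    simp only [dif_pos h]
    have h₁ := c.monotone (le_max_left k l) a _ hk
    have h₂ := c.monotone (le_max_right k l) a _ hl
    exact h₂.symm.trans h₁
  ωSup_le c v hv := fun a n hn => by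
    by_cases h : ∃ n, ∃ k, (c k).node a = some n
    · simp only [dif_pos h] at hn
      obtain ⟨l, hl⟩ := h.choose_spec
      rw [hn] at hl
      exact hv l a n hl
    · simp only [dif_neg h] at hn
      cases hn

open Classical in
theorem ωSup_node (c : OmegaCompletePartialOrder.Chain (Val S)) (a : List (Step S)) (n : Node S) :
    (OmegaCompletePartialOrder.ωSup c).node a = some n ↔ ∃ k, (c k).node a = some n := by
  constructor
  · intro h
    by_contra hk
    push Not at hk
    change (if h : ∃ n, ∃ k, (c k).node a = some n then some h.choose else none) = some n at h
    by_cases h' : ∃ n, ∃ k, (c k).node a = some n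
    · rw [dif_pos h'] at h
      obtain ⟨l, hl⟩ := h'.choose_spec
      exact hk l (hl.trans h)
    · rw [dif_neg h'] at h
      cases h
  · rintro ⟨k, hk⟩
    exact OmegaCompletePartialOrder.le_ωSup c k a n hk

@[simp] theorem sub_node (s : Step S) (v : Val S) (a : List (Step S)) :
    (sub s v).node a = v.node (s :: a) := rfl

theorem sub_mono (s : Step S) : Monotone (sub s : Val S → Val S) :=
  fun _ _ h a n hn => h (s :: a) n hn

theorem node_eq_none_of_head {v : Val S} (h : v.head = none) (a : List (Step S)) :
    v.node a = none := by
  induction a using List.reverseRecOn with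
  | nil => exact h
  | append_singleton a s ih =>
    by_contra hn
    obtain ⟨n, hn, -⟩ := v.wf a s hn
    rw [ih] at hn
    cases hn

theorem eq_bot_of_head {v : Val S} (h : v.head = none) : v = ⊥ := by
  ext1
  funext a
  exact node_eq_none_of_head h a

theorem con_mono (c : S.Con) (p : OddPrio S) : Monotone (con c p) := by
  intro u v h a n hn
  rcases a with _ | ⟨_ | d, a⟩
  · exact hn
  · exact h a n hn
  · exact hn

theorem record_mono (ds : Set S.Des) (p : EvenPrio S) : Monotone (record ds p) := by
  intro u v h a n hn
  rcases a with _ | ⟨_ | d, a⟩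
  · exact hn
  · exact hn
  · by_cases hd : d ∈ ds
    · simp only [record, dif_pos hd] at hn ⊢
      exact h ⟨d, hd⟩ a n hn
    · simp only [record, dif_neg hd] at hn
      cases hn

@[simp] theorem sub_con (c : S.Con) (p : OddPrio S) (v : Val S) : sub none (con c p v) = v := rfl

@[simp] theorem sub_record (ds : Set S.Des) (p : EvenPrio S) (v : ds → Val S) (d : ds) :
    sub (some d.1) (record ds p v) = v d := by
  ext1
  funext a
  exact dif_pos d.2

/-! Finitely generated sets of values are closed under the operations used below because they
are the closed upper sets for the topology of pointwise convergence, which is compact. -/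

theorem finite_node (S : Signature) : Finite (Node S) := by
  have := S.finite_con
  have := S.finite_des
  have : Finite (OddPrio S) := (S.Prio.finite_toSet.subset (fun _ h => h.1) : {p | _}.Finite)
  have : Finite (EvenPrio S) := (S.Prio.finite_toSet.subset (fun _ h => h.1) : {p | _}.Finite)
  refine Finite.of_injective
    (β := (S.Con × OddPrio S) ⊕ (Set S.Des × EvenPrio S))
    (fun n => match n with
      | .con c p => .inl (c, p)
      | .record ds p => .inr (ds, p)) ?_
  rintro (⟨c, p⟩ | ⟨ds, p⟩) (⟨c', p'⟩ | ⟨ds', p'⟩) h <;> simp_all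

/-- The discrete topology on labels. -/
@[reducible] def labelTopology (S : Signature) : TopologicalSpace (Option (Node S)) := ⊥

attribute [local instance] labelTopology

/-- The topology of pointwise convergence of labels. -/
@[reducible] def pointwiseTopology (S : Signature) : TopologicalSpace (Val S) :=
  TopologicalSpace.induced node Pi.topologicalSpace

attribute [local instance] pointwiseTopology

theorem labelDiscrete (S : Signature) : DiscreteTopology (Option (Node S)) := ⟨rfl⟩

attribute [local instance] labelDiscrete

theorem continuous_node (a : List (Step S)) : Continuous fun v : Val S => v.node a :=
  (continuous_apply a).comp continuous_induced_dom

theorem isClosed_label {X : Type*} [TopologicalSpace X] {f : X → Option (Node S)}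
    (hf : Continuous f) (P : Option (Node S) → Prop) : IsClosed {x | P (f x)} :=
  (isClosed_discrete {l | P l}).preimage hf

theorem isClosed_label₂ {X : Type*} [TopologicalSpace X] {f g : X → Option (Node S)}
    (hf : Continuous f) (hg : Continuous g) (P : Option (Node S) → Option (Node S) → Prop) :
    IsClosed {x | P (f x) (g x)} :=
  (isClosed_discrete {l : Option (Node S) × Option (Node S) | P l.1 l.2}).preimage
    (hf.prodMk hg)

theorem continuous_of_node {X : Type*} [TopologicalSpace X] {f : X → Val S}
    (hf : ∀ a, Continuous fun x => (f x).node a) : Continuous f :=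
  continuous_induced_rng.2 (continuous_pi hf)

theorem compactSpace (S : Signature) : CompactSpace (Val S) := by
  have := finite_node S
  have hr : IsClosed (Set.range (node : Val S → _)) := by
    have h : Set.range (node : Val S → _) = {l | ∀ a s, l (a ++ [s]) ≠ none →
        ∃ n, l a = some n ∧ n.Allows s} := by
      ext l
      exact ⟨by rintro ⟨v, rfl⟩; exact v.wf, fun h => ⟨⟨l, h⟩, rfl⟩⟩
    rw [h]
    simp only [ofPred_forall]
    refine isClosed_iInter fun a => isClosed_iInter fun s => ?_
    have := isClosed_label₂ (S := S) (continuous_apply (A := fun _ => Option (Node S)) (a ++ [s]))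
      (continuous_apply (A := fun _ => Option (Node S)) a)
      (fun l m => l ≠ none → ∃ n, m = some n ∧ n.Allows s)
    simpa only [ofPred_forall] using this
  have hinj : Function.Injective (node : Val S → _) := fun u v h => Val.ext h
  have hemb : Topology.IsClosedEmbedding (node : Val S → _) :=
    ⟨⟨⟨rfl⟩, hinj⟩, hr⟩
  exact hemb.compactSpace

attribute [local instance] compactSpace

theorem isClosed_le {X : Type*} [TopologicalSpace X] {f g : X → Val S}
    (hf : Continuous f) (hg : Continuous g) : IsClosed {x | f x ≤ g x} := by
  simp only [le_def, ofPred_forall]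
  refine isClosed_iInter fun a => isClosed_iInter fun n => ?_
  have := isClosed_label₂ ((continuous_node a).comp hf) ((continuous_node a).comp hg)
    (fun l m => l = some n → m = some n)
  exact this

theorem continuous_sub (s : Step S) : Continuous (sub s : Val S → Val S) :=
  continuous_of_node fun a => continuous_node (s :: a)

theorem continuous_con (c : S.Con) (p : OddPrio S) : Continuous (con c p) := by
  refine continuous_of_node fun a => ?_
  rcases a with _ | ⟨_ | d, a⟩
  · exact continuous_const
  · exact continuous_node a
  · exact continuous_const

theorem continuous_record (ds : Set S.Des) (p : EvenPrio S) : Continuous (record ds p) := by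
  refine continuous_of_node fun a => ?_
  rcases a with _ | ⟨_ | d, a⟩
  · exact continuous_const
  · exact continuous_const
  · by_cases hd : d ∈ ds
    · simp only [record, dif_pos hd]
      exact (continuous_node a).comp (continuous_apply (⟨d, hd⟩ : ds))
    · simp only [record, dif_neg hd]
      exact continuous_const

/-- The upward closure of the image of a closed set of values by a closed relation. -/
theorem isClosed_image {X : Type*} [TopologicalSpace X] [CompactSpace X] {U : Set X}
    (hU : IsClosed U) {R : X → Val S → Prop} (hR : IsClosed {x : X × Val S | R x.1 x.2}) :
    IsClosed {w | ∃ u ∈ U, R u w} := by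
  have h := isClosedMap_snd_of_compactSpace (X := X) (Y := Val S) _
    ((hU.preimage continuous_fst).inter hR)
  convert h using 1
  ext w
  simp

/-- Truncation of a value at a given depth. -/
def trunc (k : ℕ) (v : Val S) : Val S where
  node a := if a.length < k then v.node a else none
  wf a s h := by
    by_cases hk : (a ++ [s]).length < k
    · rw [if_pos hk] at h
      have : a.length < k := by simp at hk; omega
      simpa only [if_pos this] using v.wf a s h
    · exact absurd (if_neg hk) h

theorem finite_addresses (S : Signature) (k : ℕ) : {a : List (Step S) | a.length < k}.Finite := by
  have := S.finite_des
  exact List.finite_length_lt (Step S) k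

theorem isFinite_trunc (k : ℕ) (v : Val S) : (trunc k v).IsFinite := by
  refine (finite_addresses S k).subset fun a ha => ?_
  by_contra h
  exact ha (if_neg h)

theorem finite_range_trunc (k : ℕ) : (Set.range (trunc k : Val S → Val S)).Finite := by
  have := finite_node S
  have := (finite_addresses S k).to_subtype
  let F : ({a : List (Step S) | a.length < k} → Option (Node S)) → Set (Val S) :=
    fun l => {u | u ∈ Set.range (trunc k) ∧ ∀ a, u.node a.1 = l a}
  have hF : ∀ l, (F l).Subsingleton := by
    rintro l _ ⟨⟨u, rfl⟩, hu⟩ _ ⟨⟨v, rfl⟩, hv⟩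
    ext1
    funext a
    by_cases ha : a.length < k
    · rw [hu ⟨a, ha⟩, hv ⟨a, ha⟩]
    · simp [trunc, ha]
  refine (Set.finite_iUnion fun l => (hF l).finite).subset fun u hu => ?_
  exact mem_iUnion.2 ⟨fun a => u.node a.1, hu, fun _ => rfl⟩

theorem trunc_le (k : ℕ) (v : Val S) : trunc k v ≤ v := by
  intro a n h
  by_cases ha : a.length < k
  · simpa [trunc, ha] using h
  · simp [trunc, ha] at h

theorem trunc_mono {k l : ℕ} (h : k ≤ l) (v : Val S) : trunc k v ≤ trunc l v := by
  intro a n hn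
  by_cases ha : a.length < k
  · simpa [trunc, ha, lt_of_lt_of_le ha h] using hn
  · simp [trunc, ha] at hn

theorem continuous_trunc (k : ℕ) : Continuous (trunc k : Val S → Val S) := by
  refine continuous_of_node fun a => ?_
  by_cases ha : a.length < k
  · simpa [trunc, ha] using continuous_node a
  · simpa [trunc, ha] using continuous_const

/-- The set of values above some element of a set of values. -/
def up (F : Set (Val S)) : Set (Val S) := {v | ∃ u ∈ F, u ≤ v}

/-- Finitely generated sets of values (the empty set is allowed): the upper sets that are limits
of a chain of finite sums of finite values. The limit of a chain is the intersection of the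
corresponding upper sets. -/
def FinitelyGenerated (U : Set (Val S)) : Prop :=
  ∃ F : ℕ → Set (Val S), (∀ k, (F k).Finite ∧ ∀ u ∈ F k, u.IsFinite) ∧
    (∀ k, up (F (k + 1)) ⊆ up (F k)) ∧ U = ⋂ k, up (F k)

theorem finitelyGenerated_iff {U : Set (Val S)} :
    FinitelyGenerated U ↔ IsClosed U ∧ ∀ u ∈ U, ∀ v, u ≤ v → v ∈ U := by
  constructor
  · rintro ⟨F, hF, -, rfl⟩
    refine ⟨isClosed_iInter fun k => ?_, fun u hu v huv => ?_⟩
    · have : up (F k) = ⋃ u ∈ F k, {v | u ≤ v} := by ext; simp [up]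
      rw [this]
      exact (hF k).1.isClosed_biUnion fun u _ => isClosed_le continuous_const continuous_id
    · simp only [mem_iInter] at hu ⊢
      intro k
      obtain ⟨w, hw, hwu⟩ := hu k
      exact ⟨w, hw, hwu.trans huv⟩
  · rintro ⟨hc, hu⟩
    refine ⟨fun k => trunc k '' U, fun k => ⟨(finite_range_trunc k).subset
      (image_subset_range _ _), ?_⟩, fun k => ?_, ?_⟩
    · rintro _ ⟨u, -, rfl⟩
      exact isFinite_trunc k u
    · rintro v ⟨_, ⟨u, huU, rfl⟩, huv⟩
      exact ⟨_, ⟨u, huU, rfl⟩, (trunc_mono k.le_succ u).trans huv⟩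
    · ext v
      constructor
      · exact fun hv => mem_iInter.2 fun k => ⟨_, ⟨v, hv, rfl⟩, trunc_le k v⟩
      · intro hv
        have hne := IsCompact.nonempty_iInter_of_sequence_nonempty_isCompact_isClosed
          (fun k => U ∩ {u | trunc k u ≤ v})
          (fun k u hu => ⟨hu.1, (trunc_mono k.le_succ u).trans hu.2⟩)
          (fun k => by
            obtain ⟨_, ⟨u, huU, rfl⟩, huv⟩ := mem_iInter.1 hv k
            exact ⟨u, huU, huv⟩)
          (hc.inter (isClosed_le (continuous_trunc 0) continuous_const)).isCompact
          (fun k => hc.inter (isClosed_le (continuous_trunc k) continuous_const))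
        obtain ⟨u, huv⟩ := hne
        rw [mem_iInter] at huv
        refine hu u (huv 0).1 v fun a n hn => ?_
        refine (huv (a.length + 1)).2 a n ?_
        simpa [trunc] using hn

end Val

/-! ## Values with approximations -/

/-- The domain `𝔸` of values with approximations: the Smyth power domain of the domain of values,
with the empty sum. A sum of values is represented by the set of all the values above one of
its summands. -/
@[ext]
structure Apx (S : Signature) : Type where
  carrier : Set (Val S)
  finGen : Val.FinitelyGenerated carrier

namespace Apx

instance : Membership (Val S) (Apx S) := ⟨fun U v => v ∈ U.carrier⟩

/-- The order on `𝔸` is reverse inclusion of the representatives. -/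
instance : PartialOrder (Apx S) where
  le U V := V.carrier ⊆ U.carrier
  le_refl _ := Subset.rfl
  le_trans _ _ _ h₁ h₂ := Subset.trans h₂ h₁
  le_antisymm _ _ h₁ h₂ := Apx.ext (Subset.antisymm h₂ h₁)

/-- An element of `𝔸` is total when all its summands are. (Total values are maximal, so all the
elements of the representative can be considered.) -/
def Total (U : Apx S) : Prop := ∀ v ∈ U, v.Total

attribute [local instance] Val.labelTopology Val.pointwiseTopology Val.labelDiscrete
  Val.compactSpace

theorem isClosed (U : Apx S) : IsClosed U.carrier := (Val.finitelyGenerated_iff.1 U.finGen).1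

theorem upper (U : Apx S) {u v : Val S} (hu : u ∈ U) (h : u ≤ v) : v ∈ U :=
  (Val.finitelyGenerated_iff.1 U.finGen).2 u hu v h

/-- The least element `⊥`, represented by the set of all values. -/
def bot : Apx S := ⟨univ, Val.finitelyGenerated_iff.2 ⟨isClosed_univ, fun _ _ _ _ => trivial⟩⟩

/-- The empty sum, the greatest element of `𝔸`. -/
def zero : Apx S := ⟨∅, Val.finitelyGenerated_iff.2 ⟨isClosed_empty, fun _ h => h.elim⟩⟩

/-- The value `v`, seen as a sum with one summand. -/
def single (v : Val S) : Apx S :=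
  ⟨{w | v ≤ w}, Val.finitelyGenerated_iff.2
    ⟨Val.isClosed_le continuous_const continuous_id, fun _ h _ h' => le_trans h h'⟩⟩

/-- The linear extension of `C^p`. -/
def con (c : S.Con) (p : OddPrio S) (U : Apx S) : Apx S :=
  ⟨{w | ∃ u ∈ U.carrier, Val.con c p u ≤ w}, Val.finitelyGenerated_iff.2
    ⟨Val.isClosed_image U.isClosed
      (Val.isClosed_le ((Val.continuous_con c p).comp continuous_fst) continuous_snd),
      fun _ ⟨u, hu, h⟩ _ h' => ⟨u, hu, h.trans h'⟩⟩⟩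

/-- The multilinear extension of the record construction. -/
noncomputable def record (ds : Set S.Des) (p : EvenPrio S) (U : ds → Apx S) : Apx S :=
  ⟨{w | ∃ u ∈ {u : ds → Val S | ∀ d, u d ∈ (U d).carrier}, Val.record ds p u ≤ w},
    Val.finitelyGenerated_iff.2
      ⟨Val.isClosed_image
        (by
          simp only [ofPred_forall]
          exact isClosed_iInter fun d => (U d).isClosed.preimage (continuous_apply d))
        (Val.isClosed_le ((Val.continuous_record ds p).comp continuous_fst) continuous_snd),
        fun _ ⟨u, hu, h⟩ _ h' => ⟨u, hu, h.trans h'⟩⟩⟩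

end Apx

namespace Val

open Classical in
/-- The operation `(C^p)⁻`, which removes the constructor `C^p`; the result `none` stands for the
error `𝟎`. -/
noncomputable def conInv (c : S.Con) (p : OddPrio S) (v : Val S) : Option (Val S) :=
  match v.head with
  | none => some ⊥
  | some n => if n = .con c p then some (v.sub none) else none

open Classical in
/-- The operation `D^p`, which projects a record of priority `p` on its field `D`; the
result `none` stands for the error `𝟎`. -/
noncomputable def proj (d : S.Des) (p : EvenPrio S) (v : Val S) : Option (Val S) :=
  match v.head with
  | none => some ⊥
  | some n => if ∃ ds, d ∈ ds ∧ n = .record ds p then some (v.sub (some d)) else none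

attribute [local instance] Val.labelTopology Val.pointwiseTopology Val.labelDiscrete
  Val.compactSpace

/-- A partial operation that is a subvalue on labels satisfying `P`, and preserves `⊥`. -/
theorem isClosed_destruct {φ : Val S → Option (Val S)} (s : Step S) (P : Node S → Prop)
    (h₀ : ∀ v, v.head = none → φ v = some ⊥)
    (h₁ : ∀ v n, v.head = some n → P n → φ v = some (v.sub s))
    (h₂ : ∀ v n, v.head = some n → ¬ P n → φ v = none) :
    IsClosed {x : Val S × Val S | ∃ w' ∈ φ x.1, w' ≤ x.2} := by
  have h : {x : Val S × Val S | ∃ w' ∈ φ x.1, w' ≤ x.2} =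
      {x | ∀ n, x.1.head = some n → P n} ∩ {x | x.1.sub s ≤ x.2} := by
    ext ⟨u, w⟩
    simp only [mem_ofPred_eq, mem_inter_iff]
    rcases hu : u.head with _ | n
    · have : u = ⊥ := eq_bot_of_head hu
      subst this
      have hs : sub s (⊥ : Val S) = ⊥ := rfl
      simp [h₀ _ hu, hs]
    · by_cases hP : P n
      · simp [h₁ _ _ hu hP, hP]
      · simp [h₂ _ _ hu hP, hP]
  rw [h]
  refine IsClosed.inter ?_ (isClosed_le ((continuous_sub s).comp continuous_fst) continuous_snd)
  exact isClosed_label ((continuous_node []).comp continuous_fst) fun l => ∀ n, l = some n → P n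

theorem isClosed_conInv (c : S.Con) (p : OddPrio S) :
    IsClosed {x : Val S × Val S | ∃ w' ∈ conInv c p x.1, w' ≤ x.2} := by
  refine isClosed_destruct none (fun n => n = .con c p) ?_ ?_ ?_
  · intro v h; simp [conInv, h]
  · intro v n h hn; simp [conInv, h, hn]
  · intro v n h hn; simp [conInv, h, hn]

theorem isClosed_proj (d : S.Des) (p : EvenPrio S) :
    IsClosed {x : Val S × Val S | ∃ w' ∈ proj d p x.1, w' ≤ x.2} := by
  refine isClosed_destruct (some d) (fun n => ∃ ds, d ∈ ds ∧ n = .record ds p) ?_ ?_ ?_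
  · intro v h; simp [proj, h]
  · intro v n h hn; simp only [proj, h, if_pos hn]
  · intro v n h hn; simp only [proj, h, if_neg hn]

end Val

namespace Apx

attribute [local instance] Val.labelTopology Val.pointwiseTopology Val.labelDiscrete
  Val.compactSpace

/-- The linear extension of `(C^p)⁻`. -/
def conInv (c : S.Con) (p : OddPrio S) (U : Apx S) : Apx S :=
  ⟨{w | ∃ u ∈ U.carrier, ∃ w' ∈ Val.conInv c p u, w' ≤ w}, Val.finitelyGenerated_iff.2
    ⟨Val.isClosed_image U.isClosed (Val.isClosed_conInv c p),
      fun _ ⟨u, hu, w', hw', h⟩ _ h' => ⟨u, hu, w', hw', h.trans h'⟩⟩⟩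

/-- The linear extension of `D^p`. -/
def proj (d : S.Des) (p : EvenPrio S) (U : Apx S) : Apx S :=
  ⟨{w | ∃ u ∈ U.carrier, ∃ w' ∈ Val.proj d p u, w' ≤ w}, Val.finitelyGenerated_iff.2
    ⟨Val.isClosed_image U.isClosed (Val.isClosed_proj d p),
      fun _ ⟨u, hu, w', hw', h⟩ _ h' => ⟨u, hu, w', hw', h.trans h'⟩⟩⟩

open Classical in
/-- The least function from `𝔸` to `𝔸` that preserves the error `𝟎`. -/
noncomputable def daimon (U : Apx S) : Apx S := if U = zero then zero else bot

/-- The limit of a chain of elements of `𝔸`. -/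
def lim (U : ℕ → Apx S) : Apx S :=
  ⟨⋂ k, (U k).carrier, Val.finitelyGenerated_iff.2
    ⟨isClosed_iInter fun k => (U k).isClosed,
      fun _ hu _ h => mem_iInter.2 fun k => (U k).upper (mem_iInter.1 hu k) h⟩⟩

theorem isLUB_lim (U : ℕ → Apx S) : IsLUB (Set.range U) (lim U) := by
  constructor
  · rintro _ ⟨k, rfl⟩
    exact iInter_subset _ k
  · intro V hV
    exact subset_iInter fun k => hV ⟨k, rfl⟩

end Apx

/-! ## The language of operators -/

/-- The terms of the language of operators. The recursive function `f` being defined has its own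
construction `call`; the type `Fn` contains the names of the other functions. -/
inductive Term (S : Signature) (Fn : Type) : Type
  /-- `C^p t` -/
  | con (c : S.Con) (p : OddPrio S) (t : Term S Fn) : Term S Fn
  /-- `{…; d = t d; …}^p` -/
  | record (ds : Set S.Des) (p : EvenPrio S) (t : ds → Term S Fn) : Term S Fn
  /-- `(C^p)⁻ t` -/
  | conInv (c : S.Con) (p : OddPrio S) (t : Term S Fn) : Term S Fn
  /-- `D^p t` -/
  | proj (d : S.Des) (p : EvenPrio S) (t : Term S Fn) : Term S Fn
  /-- the formal parameter `x` -/
  | x : Term S Fn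
  /-- `✠ {θ 0, …, θ (n - 1)}` -/
  | daimon (n : ℕ) (θ : Fin n → Term S Fn) : Term S Fn
  /-- `f t`, where `f` is the function being defined -/
  | call (t : Term S Fn) : Term S Fn
  /-- `g t`, where `g` is another function -/
  | fn (g : Fn) (t : Term S Fn) : Term S Fn
  /-- the error `𝟎` -/
  | zero : Term S Fn

namespace Term

variable {Fn : Type}

/-- `t[x := r]` -/
def subst (r : Term S Fn) : Term S Fn → Term S Fn
  | con c p t => con c p (subst r t)
  | record ds p t => record ds p fun d => subst r (t d)
  | conInv c p t => conInv c p (subst r t)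
  | proj d p t => proj d p (subst r t)
  | x => r
  | daimon n θ => daimon n fun i => subst r (θ i)
  | call t => call (subst r t)
  | fn g t => fn g (subst r t)
  | zero => zero

/-- `✠ t` -/
def daimon₁ (t : Term S Fn) : Term S Fn := daimon 1 fun _ => t

/-- The interpretation of a term as a function from `𝔸` to itself, where `ρ` interprets the other
functions and `f` the function being defined. -/
noncomputable def interp (ρ : Fn → Apx S → Apx S) (f : Apx S → Apx S) :
    Term S Fn → Apx S → Apx S
  | con c p t, U => Apx.con c p (interp ρ f t U)
  | record ds p t, U => Apx.record ds p fun d => interp ρ f (t d) U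
  | conInv c p t, U => Apx.conInv c p (interp ρ f t U)
  | proj d p t, U => Apx.proj d p (interp ρ f t U)
  | x, U => U
  | daimon _ θ, U =>
      open Classical in
      if ∃ i, interp ρ f (θ i) U = Apx.zero then Apx.zero else Apx.daimon U
  | call t, U => f (interp ρ f t U)
  | fn g t, U => ρ g (interp ρ f t U)
  | zero, _ => Apx.zero

/-- The function `f` occurs in the term. -/
def HasCall : Term S Fn → Prop
  | con _ _ t => HasCall t
  | record _ _ t => ∃ d, HasCall (t d)
  | conInv _ _ t => HasCall t
  | proj _ _ t => HasCall t
  | x => False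
  | daimon _ θ => ∃ i, HasCall (θ i)
  | call _ => True
  | fn _ t => HasCall t
  | zero => False

/-- The relation `Unfolds T s s'` means that `s' = s[σ]` for a substitution `σ` that replaces each
occurrence of `f` in `s` by one of the summands of `T`: the occurrence `f t` becomes
`r[x := t[σ]]` when it is replaced by `r`. -/
inductive Unfolds (T : Set (Term S Fn)) : Term S Fn → Term S Fn → Prop
  | con (c p) {t t'} : Unfolds T t t' → Unfolds T (con c p t) (con c p t')
  | record (ds p) {t t'} : (∀ d, Unfolds T (t d) (t' d)) →
      Unfolds T (record ds p t) (record ds p t')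
  | conInv (c p) {t t'} : Unfolds T t t' → Unfolds T (conInv c p t) (conInv c p t')
  | proj (d p) {t t'} : Unfolds T t t' → Unfolds T (proj d p t) (proj d p t')
  | x : Unfolds T x x
  | daimon (n) {θ θ'} : (∀ i, Unfolds T (θ i) (θ' i)) → Unfolds T (daimon n θ) (daimon n θ')
  | call {r t t'} : r ∈ T → Unfolds T t t' → Unfolds T (call t) (subst t' r)
  | fn (g) {t t'} : Unfolds T t t' → Unfolds T (fn g t) (fn g t')
  | zero : Unfolds T zero zero

/-- A path of the sum `T` of simple terms: `s 0 = f x`, and each `s (k + 1)` is obtained from `s k`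
by replacing all the occurrences of `f` by summands of `T`. -/
def IsPath (T : Set (Term S Fn)) (s : ℕ → Term S Fn) : Prop :=
  s 0 = call x ∧ ∀ k, Unfolds T (s k) (s (k + 1))

/-- A path is infinite if `f` occurs in all its terms. -/
def IsInfinitePath (T : Set (Term S Fn)) (s : ℕ → Term S Fn) : Prop :=
  IsPath T s ∧ ∀ k, HasCall (s k)

/-- The limit of the chain `s k (✠)`, as a function from `𝔸` to itself. -/
noncomputable def pathLimit (ρ : Fn → Apx S → Apx S) (s : ℕ → Term S Fn) (U : Apx S) : Apx S :=
  Apx.lim fun k => interp ρ Apx.daimon (s k) U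

/-- A path is total if its limit sends total elements of `𝔸` to total elements of `𝔸`. -/
def TotalPath (ρ : Fn → Apx S → Apx S) (s : ℕ → Term S Fn) : Prop :=
  ∀ U : Apx S, U.Total → (pathLimit ρ s U).Total

/-! ## The call-graph -/

/-- The term `t^✠`, in which all the function names are replaced by `✠`. No function name is left
in it. -/
def daimonize : Term S Fn → Term S Empty
  | con c p t => con c p (daimonize t)
  | record ds p t => record ds p fun d => daimonize (t d)
  | conInv c p t => conInv c p (daimonize t)
  | proj d p t => proj d p (daimonize t)
  | x => x
  | daimon n θ => daimon n fun i => daimonize (θ i)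
  | call t => daimon₁ (daimonize t)
  | fn _ t => daimon₁ (daimonize t)
  | zero => zero

/-- The summands of the call-graph `G(t)` of a term: there is one summand `β^✠ f (u^✠)` for each
occurrence `f u` of `f` in `t`, where `β` is the branch of `t` that leads to this occurrence, with
the records restricted to one field. -/
def callGraph : Term S Fn → Set (Term S Empty)
  | con c p t => con c p '' callGraph t
  | record ds p t => ⋃ d : ds, (fun r => record {d.1} p fun _ => r) '' callGraph (t d)
  | conInv c p t => conInv c p '' callGraph t
  | proj d p t => proj d p '' callGraph t
  | x => ∅
  | daimon _ θ => ⋃ i, daimon₁ '' callGraph (θ i)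
  | call t => insert (call (daimonize t)) (daimon₁ '' callGraph t)
  | fn _ t => daimon₁ '' callGraph t
  | zero => ∅

/-- The call-graph `G(T)` of a sum `T` of terms. -/
def callGraphSum (T : Set (Term S Fn)) : Set (Term S Empty) := ⋃ t ∈ T, callGraph t

end Term

/-! ## Types -/

/-- A system of inductive and coinductive types. An inductive type has a set of constructors `C^p`,
where `p` is the (odd) priority of the type, and each of them has an argument type; a coinductive
type has a set of destructors `D^p`, where `p` is the (even) priority of the type, and each of
them has a result type. The types may refer to each other in an arbitrary way. -/
structure TypeSystem (S : Signature) where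
  Data : Type
  Codata : Type
  cons : Data → Set S.Con
  dataPrio : Data → OddPrio S
  arg : (D : Data) → cons D → Data ⊕ Codata
  fields : Codata → Set S.Des
  codataPrio : Codata → EvenPrio S
  res : (D : Codata) → fields D → Data ⊕ Codata

namespace TypeSystem

variable (𝒯 : TypeSystem S)

abbrev Ty : Type := 𝒯.Data ⊕ 𝒯.Codata

/-- One step of the verification that a value has a type, where `R` is used for the children. -/
def Step (R : 𝒯.Ty → Val S → Prop) : 𝒯.Ty → Val S → Prop
  | .inl D, v => v.head = none ∨
      ∃ c : 𝒯.cons D, v.head = some (.con c.1 (𝒯.dataPrio D)) ∧ R (𝒯.arg D c) (v.sub none)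
  | .inr D, v => v.head = none ∨
      (v.head = some (.record (𝒯.fields D) (𝒯.codataPrio D)) ∧
        ∀ d : 𝒯.fields D, R (𝒯.res D d) (v.sub (some d.1)))

/-- A value has a type (coinductively) if it is `⊥`, or if the type is inductive and the value is
of the form `C^p v` where `v` has the type of the argument of the constructor `C^p` of the type,
or if the type is coinductive and the value is a record that has the destructors of the type
as its fields, with values of the corresponding types. -/
def HasType (A : 𝒯.Ty) (v : Val S) : Prop :=
  ∃ R : 𝒯.Ty → Val S → Prop, (∀ A v, R A v → 𝒯.Step R A v) ∧ R A v

variable {𝒯}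

theorem Step.mono {R R' : 𝒯.Ty → Val S → Prop} (h : ∀ A v, R A v → R' A v) {A : 𝒯.Ty} {v : Val S}
    (hv : 𝒯.Step R A v) : 𝒯.Step R' A v := by
  rcases A with D | D
  · rcases hv with hv | ⟨c, hc, hv⟩
    · exact .inl hv
    · exact .inr ⟨c, hc, h _ _ hv⟩
  · rcases hv with hv | ⟨hd, hv⟩
    · exact .inl hv
    · exact .inr ⟨hd, fun d => h _ _ (hv d)⟩

theorem hasType_iff {A : 𝒯.Ty} {v : Val S} : 𝒯.HasType A v ↔ 𝒯.Step 𝒯.HasType A v := by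
  have h : ∀ A v, 𝒯.HasType A v → 𝒯.Step 𝒯.HasType A v := fun A v ⟨R, hR, h⟩ =>
    (hR A v h).mono fun A v h => ⟨R, hR, h⟩
  exact ⟨h A v, fun hv => ⟨𝒯.Step 𝒯.HasType, fun _ _ h' => Step.mono h h', hv⟩⟩

theorem hasType_bot (A : 𝒯.Ty) : 𝒯.HasType A ⊥ :=
  hasType_iff.2 (by rcases A with D | D <;> exact .inl rfl)

theorem hasType_ωSup {A : 𝒯.Ty} (c : OmegaCompletePartialOrder.Chain (Val S))
    (hc : ∀ v ∈ c, 𝒯.HasType A v) : 𝒯.HasType A (OmegaCompletePartialOrder.ωSup c) := by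
  refine ⟨fun A v => ∃ c : OmegaCompletePartialOrder.Chain (Val S), (∀ k, 𝒯.HasType A (c k)) ∧
    ∀ a n, v.node a = some n ↔ ∃ k, (c k).node a = some n, ?_,
    c, fun k => hc _ ⟨k, rfl⟩, Val.ωSup_node c⟩
  clear hc c A
  rintro A v ⟨c, hc, hv⟩
  have key : ∀ s n, v.head = some n → (∃ l, ∀ k, (c (l + k)).head = some n) ∧
      ∀ l, ∃ c' : OmegaCompletePartialOrder.Chain (Val S), (∀ k, c' k = (c (l + k)).sub s) ∧
        ∀ a n, (v.sub s).node a = some n ↔ ∃ k, (c' k).node a = some n := by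
    intro s n hn
    obtain ⟨l, hl⟩ := (hv [] n).1 hn
    refine ⟨⟨l, fun k => c.monotone (Nat.le_add_right l k) _ _ hl⟩, fun l => ?_⟩
    refine ⟨⟨fun k => (c (l + k)).sub s, fun i j hij =>
      Val.sub_mono s (c.monotone (Nat.add_le_add_left hij l))⟩, fun _ => rfl, fun a m => ?_⟩
    rw [Val.sub_node, hv]
    constructor
    · rintro ⟨k, hk⟩
      exact ⟨k, c.monotone (Nat.le_add_left k l) _ _ hk⟩
    · rintro ⟨k, hk⟩
      exact ⟨l + k, hk⟩
  rcases hn : v.head with _ | n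
  · rcases A with D | D <;> exact .inl hn
  · obtain ⟨⟨l, hl⟩, -⟩ := key none n hn
    have hl₀ := hl 0
    rcases A with D | D
    · right
      rcases hasType_iff.1 (hc l) with h | ⟨con, hcon, -⟩
      · simp [h] at hl₀
      · have hncon : n = .con con.1 (𝒯.dataPrio D) := by simpa [hcon, eq_comm] using hl₀
        refine ⟨con, by rw [hn, hncon], ?_⟩
        obtain ⟨c', hc', hv'⟩ := (key none n hn).2 l
        refine ⟨c', fun k => ?_, hv'⟩
        rw [hc']
        rcases hasType_iff.1 (hc (l + k)) with h | ⟨con', hcon', ht⟩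
        · have := hl k
          rw [h] at this
          cases this
        · have := hl k
          rw [hcon', hncon] at this
          have heq : con' = con := by
            apply Subtype.ext
            simpa using this
          exact heq ▸ ht
    · right
      rcases hasType_iff.1 (hc l) with h | ⟨hrec, -⟩
      · simp [h] at hl₀
      · have hnrec : n = .record (𝒯.fields D) (𝒯.codataPrio D) := by
          simpa [hrec, eq_comm] using hl₀
        refine ⟨by rw [hn, hnrec], fun d => ?_⟩
        obtain ⟨c', hc', hv'⟩ := (key (some d.1) n hn).2 l
        refine ⟨c', fun k => ?_, hv'⟩
        rw [hc']
        rcases hasType_iff.1 (hc (l + k)) with h | ⟨-, ht⟩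
        · have := hl k
          rw [h] at this
          cases this
        · exact ht d

variable (𝒯)

/-- The domain `⟦A⟧` of the values of type `A`. -/
@[ext]
structure Sem (A : 𝒯.Ty) : Type where
  val : Val S
  hasType : 𝒯.HasType A val

variable {𝒯}

namespace Sem

instance (A : 𝒯.Ty) : PartialOrder (𝒯.Sem A) :=
  PartialOrder.lift Sem.val fun _ _ h => Sem.ext h

noncomputable instance (A : 𝒯.Ty) : OmegaCompletePartialOrder (𝒯.Sem A) :=
  OmegaCompletePartialOrder.lift ⟨Sem.val, fun _ _ h => h⟩
    (fun c => ⟨OmegaCompletePartialOrder.ωSup (c.map ⟨Sem.val, fun _ _ h => h⟩),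
      hasType_ωSup _ fun _ ⟨k, hk⟩ => hk ▸ (c k).hasType⟩)
    (fun _ _ h => h) fun _ => rfl

instance (A : 𝒯.Ty) : OrderBot (𝒯.Sem A) where
  bot := ⟨⊥, hasType_bot A⟩
  bot_le v := (bot_le : ⊥ ≤ v.1)

/-- `C^p v` -/
def con (D : 𝒯.Data) (c : 𝒯.cons D) (v : 𝒯.Sem (𝒯.arg D c)) : 𝒯.Sem (.inl D) :=
  ⟨Val.con c.1 (𝒯.dataPrio D) v.1, hasType_iff.2 (.inr ⟨c, rfl, v.2⟩)⟩

/-- `{…; d = v d; …}^p`, with all the fields `d` of the type. -/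
noncomputable def record (D : 𝒯.Codata) (v : ∀ d, 𝒯.Sem (𝒯.res D d)) : 𝒯.Sem (.inr D) :=
  ⟨Val.record (𝒯.fields D) (𝒯.codataPrio D) fun d => (v d).1,
    hasType_iff.2 (.inr ⟨rfl, fun d => by rw [Val.sub_record]; exact (v d).2⟩)⟩

/-- The field `d` of a record (`⊥` if the record is `⊥`). -/
def proj (D : 𝒯.Codata) (d : 𝒯.fields D) (v : 𝒯.Sem (.inr D)) : 𝒯.Sem (𝒯.res D d) :=
  ⟨v.1.sub (some d.1), by
    rcases hasType_iff.1 v.2 with h | ⟨-, h⟩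
    · rw [Val.eq_bot_of_head h]
      exact hasType_bot _
    · exact h d⟩

open Classical in
/-- The argument of the constructor `c` in a value (`⊥` if the value does not start with `c`). -/
noncomputable def unCon (D : 𝒯.Data) (c : 𝒯.cons D) (v : 𝒯.Sem (.inl D)) : 𝒯.Sem (𝒯.arg D c) :=
  if h : v.1.head = some (.con c.1 (𝒯.dataPrio D)) then
    ⟨v.1.sub none, by
      rcases hasType_iff.1 v.2 with h' | ⟨c', h', hv⟩
      · simp [h'] at h
      · rw [h'] at h
        have heq : c' = c := Subtype.ext (by simpa using h)
        exact heq ▸ hv⟩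
  else ⊥

def Total {A : 𝒯.Ty} (v : 𝒯.Sem A) : Prop := v.1.Total

end Sem

end TypeSystem

open TypeSystem

/-! ## Recursive definitions -/

/-- The names of previously defined functions, with their types. -/
structure FunSig {S : Signature} (𝒯 : TypeSystem S) where
  Fn : Type
  dom : Fn → 𝒯.Ty
  cod : Fn → 𝒯.Ty

/-- A function between domains of values is total when it sends total values to total values. -/
def TotalFun {𝒯 : TypeSystem S} {A B : 𝒯.Ty} (f : 𝒯.Sem A → 𝒯.Sem B) : Prop :=
  ∀ v, v.Total → (f v).Total

/-- Environments: a continuous function for each function name. -/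
structure Env {𝒯 : TypeSystem S} (Φ : FunSig 𝒯) where
  app : (g : Φ.Fn) → 𝒯.Sem (Φ.dom g) → 𝒯.Sem (Φ.cod g)
  continuous : ∀ g, ScottContinuous (app g)

def Env.Total {𝒯 : TypeSystem S} {Φ : FunSig 𝒯} (ρ : Env Φ) : Prop := ∀ g, TotalFun (ρ.app g)

/-- Well-typed linear patterns `p ::= y | C^p p | {D₁ = p₁; …; D_k = p_k}^p`. The variables
of a pattern are not named, they are its positions of the form `y`. -/
inductive Pat {S : Signature} (𝒯 : TypeSystem S) : 𝒯.Ty → Type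
  | var (A : 𝒯.Ty) : Pat 𝒯 A
  | con (D : 𝒯.Data) (c : 𝒯.cons D) (q : Pat 𝒯 (𝒯.arg D c)) : Pat 𝒯 (.inl D)
  | record (D : 𝒯.Codata) (q : ∀ d : 𝒯.fields D, Pat 𝒯 (𝒯.res D d)) : Pat 𝒯 (.inr D)

namespace Pat

variable {𝒯 : TypeSystem S}

/-- The variables of a pattern. -/
def Var : {A : 𝒯.Ty} → Pat 𝒯 A → Type
  | _, var _ => Unit
  | _, con _ _ q => Var q
  | _, record _ q => Σ d, Var (q d)

/-- The type of a variable of a pattern. -/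
def varType : {A : 𝒯.Ty} → (q : Pat 𝒯 A) → q.Var → 𝒯.Ty
  | A, var _, _ => A
  | _, con _ _ q, y => varType q y
  | _, record _ q, y => varType (q y.1) y.2

/-- The pattern matches the value. -/
def Matches : {A : 𝒯.Ty} → Pat 𝒯 A → 𝒯.Sem A → Prop
  | _, var _, _ => True
  | _, con D c q, v => v.1.head = some (.con c.1 (𝒯.dataPrio D)) ∧ Matches q (Sem.unCon D c v)
  | _, record D q, v => v.1.head ≠ none ∧ ∀ d, Matches (q d) (Sem.proj D d v)

/-- The pattern does not match the value, because of a constructor of the value. (The value `⊥`,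
when a constructor or a record is expected, neither matches nor fails to match.) -/
def Fails : {A : 𝒯.Ty} → Pat 𝒯 A → 𝒯.Sem A → Prop
  | _, var _, _ => False
  | _, con D c q, v => v.1.head ≠ none ∧
      (v.1.head = some (.con c.1 (𝒯.dataPrio D)) → Fails q (Sem.unCon D c v))
  | _, record D q, v => v.1.head ≠ none ∧ ∃ d, Fails (q d) (Sem.proj D d v)

/-- The unifier `[p := v]`, which gives the values of the variables when the pattern `p` matches
the value `v`. -/
noncomputable def unifier : {A : 𝒯.Ty} → (q : Pat 𝒯 A) → 𝒯.Sem A → (y : q.Var) → 𝒯.Sem (q.varType y)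
  | _, var _, v, _ => v
  | _, con D c q, v, y => unifier q (Sem.unCon D c v) y
  | _, record D q, v, y => unifier (q y.1) (Sem.proj D y.1 v) y.2

/-- The substitution `σ_p`, where the argument of the function is represented by the term `t`:
each variable is sent to the term that extracts its value from the argument. -/
def extract {Fn : Type} : {A : 𝒯.Ty} → (q : Pat 𝒯 A) → Term S Fn → q.Var → Term S Fn
  | _, var _, t, _ => t
  | _, con D c q, t, y => extract q (.conInv c.1 (𝒯.dataPrio D) t) y
  | _, record D q, t, y => extract (q y.1) (.proj y.1.1 (𝒯.codataPrio D) t) y.2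

end Pat

/-- Well-typed right-hand sides of clauses, for a definition of `f : A → B`, with typed variables.
The last index is the type of the expression. -/
inductive Expr {S : Signature} {𝒯 : TypeSystem S} (Φ : FunSig 𝒯) (A B : 𝒯.Ty) {V : Type}
    (τ : V → 𝒯.Ty) : 𝒯.Ty → Type
  | var (y : V) : Expr Φ A B τ (τ y)
  | con (D : 𝒯.Data) (c : 𝒯.cons D) (e : Expr Φ A B τ (𝒯.arg D c)) : Expr Φ A B τ (.inl D)
  | record (D : 𝒯.Codata) (e : ∀ d : 𝒯.fields D, Expr Φ A B τ (𝒯.res D d)) :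
      Expr Φ A B τ (.inr D)
  | proj (D : 𝒯.Codata) (d : 𝒯.fields D) (e : Expr Φ A B τ (.inr D)) : Expr Φ A B τ (𝒯.res D d)
  | call (e : Expr Φ A B τ A) : Expr Φ A B τ B
  | fn (g : Φ.Fn) (e : Expr Φ A B τ (Φ.dom g)) : Expr Φ A B τ (Φ.cod g)

namespace Expr

variable {𝒯 : TypeSystem S} {Φ : FunSig 𝒯} {A B : 𝒯.Ty} {V : Type} {τ : V → 𝒯.Ty}

/-- The value of an expression, where `ρ` interprets the other functions, `f` the function
being defined, and `σ` the variables. -/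
noncomputable def eval (ρ : Env Φ) (f : 𝒯.Sem A → 𝒯.Sem B) (σ : ∀ y, 𝒯.Sem (τ y)) :
    {C : 𝒯.Ty} → Expr Φ A B τ C → 𝒯.Sem C
  | _, var y => σ y
  | _, con D c e => Sem.con D c (eval ρ f σ e)
  | _, record D e => Sem.record D fun d => eval ρ f σ (e d)
  | _, proj D d e => Sem.proj D d (eval ρ f σ e)
  | _, call e => f (eval ρ f σ e)
  | _, fn g e => ρ.app g (eval ρ f σ e)

/-- The term `e[σ]` of the language of operators obtained from an expression `e`. -/
def toTerm (σ : V → Term S Φ.Fn) : {C : 𝒯.Ty} → Expr Φ A B τ C → Term S Φ.Fn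
  | _, var y => σ y
  | _, con D c e => .con c.1 (𝒯.dataPrio D) (toTerm σ e)
  | _, record D e => .record (𝒯.fields D) (𝒯.codataPrio D) fun d => toTerm σ (e d)
  | _, proj D d e => .proj d.1 (𝒯.codataPrio D) (toTerm σ e)
  | _, call e => .call (toTerm σ e)
  | _, fn g e => .fn g (toTerm σ e)

end Expr

/-- A clause `f p = u`. -/
structure Clause {S : Signature} {𝒯 : TypeSystem S} (Φ : FunSig 𝒯) (A B : 𝒯.Ty) where
  pat : Pat 𝒯 A
  rhs : Expr Φ A B pat.varType B

/-- A well-typed recursive definition of a function `f : A → B` by a list of clauses. Every total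
argument is matched by some clause. -/
structure RecDef {S : Signature} {𝒯 : TypeSystem S} (Φ : FunSig 𝒯) (A B : 𝒯.Ty) where
  clauses : List (Clause Φ A B)
  exhaustive : ∀ v : 𝒯.Sem A, v.Total → ∃ cl ∈ clauses, cl.pat.Matches v

section Semantics

variable {𝒯 : TypeSystem S} {Φ : FunSig 𝒯} {A B : 𝒯.Ty}

open Classical in
/-- The value of the first clause that matches the argument `v`. The result is `⊥` if
the clauses need more information on `v` than is available to select one. -/
noncomputable def applyClauses (ρ : Env Φ) (f : 𝒯.Sem A → 𝒯.Sem B) (v : 𝒯.Sem A) :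
    List (Clause Φ A B) → 𝒯.Sem B
  | [] => ⊥
  | cl :: l =>
    if cl.pat.Matches v then cl.rhs.eval ρ f (cl.pat.unifier v)
    else if cl.pat.Fails v then applyClauses ρ f v l
    else ⊥

theorem unCon_mono (D : 𝒯.Data) (c : 𝒯.cons D) : Monotone (Sem.unCon D c) := by
  intro u v h
  by_cases hu : u.1.head = some (.con c.1 (𝒯.dataPrio D))
  · have hv : v.1.head = some (.con c.1 (𝒯.dataPrio D)) := h [] _ hu
    rw [Sem.unCon, Sem.unCon, dif_pos hu, dif_pos hv]
    exact Val.sub_mono none h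
  · rw [Sem.unCon, dif_neg hu]
    exact bot_le

theorem proj_mono (D : 𝒯.Codata) (d : 𝒯.fields D) : Monotone (Sem.proj D d) :=
  fun _ _ h => Val.sub_mono (some d.1) h

theorem head_ne_none {u v : 𝒯.Sem A} (h : u ≤ v) (hu : u.1.head ≠ none) : v.1.head ≠ none := by
  obtain ⟨n, hn⟩ := Option.ne_none_iff_exists'.1 hu
  have hv : v.1.head = some n := h [] n hn
  simp [hv]

theorem Pat.Matches.mono {A : 𝒯.Ty} {q : Pat 𝒯 A} {u v : 𝒯.Sem A} (h : u ≤ v)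
    (hu : q.Matches u) : q.Matches v := by
  induction q with
  | var => trivial
  | con D c q ih => exact ⟨h [] _ hu.1, ih (unCon_mono D c h) hu.2⟩
  | record D q ih =>
    exact ⟨head_ne_none h hu.1, fun d => ih d (proj_mono D d h) (hu.2 d)⟩

theorem Pat.Fails.mono {A : 𝒯.Ty} {q : Pat 𝒯 A} {u v : 𝒯.Sem A} (h : u ≤ v)
    (hu : q.Fails u) : q.Fails v := by
  induction q with
  | var => exact hu
  | con D c q ih =>
    refine ⟨head_ne_none h hu.1, fun hv => ?_⟩
    obtain ⟨n, hn⟩ := Option.ne_none_iff_exists'.1 hu.1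
    have hn' : v.1.head = some n := h [] n hn
    exact ih (unCon_mono D c h) (hu.2 (hn.trans (hn'.symm.trans hv)))
  | record D q ih =>
    obtain ⟨d, hd⟩ := hu.2
    exact ⟨head_ne_none h hu.1, d, ih d (proj_mono D d h) hd⟩

theorem Pat.not_fails_of_matches {A : 𝒯.Ty} {q : Pat 𝒯 A} {v : 𝒯.Sem A} (hv : q.Matches v) :
    ¬ q.Fails v := by
  induction q with
  | var => exact id
  | con D c q ih => exact fun h => ih hv.2 (h.2 hv.1)
  | record D q ih => exact fun ⟨_, d, hd⟩ => ih d (hv.2 d) hd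

theorem Pat.unifier_mono {A : 𝒯.Ty} (q : Pat 𝒯 A) {u v : 𝒯.Sem A} (h : u ≤ v) (y : q.Var) :
    q.unifier u y ≤ q.unifier v y := by
  induction q with
  | var => exact h
  | con D c q ih => exact ih (unCon_mono D c h) y
  | record D q ih => exact ih y.1 (proj_mono D y.1 h) y.2

theorem Expr.eval_mono {V : Type} {τ : V → 𝒯.Ty} (ρ : Env Φ) {f f' : 𝒯.Sem A →o 𝒯.Sem B}
    (hf : f ≤ f') {σ σ' : ∀ y, 𝒯.Sem (τ y)} (hσ : ∀ y, σ y ≤ σ' y) {C : 𝒯.Ty}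
    (e : Expr Φ A B τ C) : e.eval ρ f σ ≤ e.eval ρ f' σ' := by
  induction e with
  | var y => exact hσ y
  | con D c e ih => exact Val.con_mono c.1 (𝒯.dataPrio D) ih
  | record D e ih => exact Val.record_mono _ _ fun d => ih d
  | proj D d e ih => exact proj_mono D d ih
  | call e ih => exact (hf _).trans (f'.monotone ih)
  | fn g e ih => exact (ρ.continuous g).monotone ih

theorem applyClauses_mono (ρ : Env Φ) {f f' : 𝒯.Sem A →o 𝒯.Sem B} (hf : f ≤ f')
    {u v : 𝒯.Sem A} (h : u ≤ v) (l : List (Clause Φ A B)) :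
    applyClauses ρ f u l ≤ applyClauses ρ f' v l := by
  induction l with
  | nil => exact le_rfl
  | cons cl l ih =>
    by_cases hu : cl.pat.Matches u
    · rw [applyClauses, applyClauses, if_pos hu, if_pos (hu.mono h)]
      exact cl.rhs.eval_mono ρ hf (cl.pat.unifier_mono h)
    · by_cases hu' : cl.pat.Fails u
      · have hv' := hu'.mono h
        have hv : ¬ cl.pat.Matches v := fun hv => Pat.not_fails_of_matches hv hv'
        rw [applyClauses, applyClauses, if_neg hu, if_pos hu', if_neg hv, if_pos hv']
        exact ih
      · rw [applyClauses, if_neg hu, if_neg hu']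
        exact bot_le

/-- The operator `Θ_f` of a recursive definition of `f`. -/
noncomputable def RecDef.operator (δ : RecDef Φ A B) (ρ : Env Φ) :
    (𝒯.Sem A →o 𝒯.Sem B) →o (𝒯.Sem A →o 𝒯.Sem B) where
  toFun f := ⟨fun v => applyClauses ρ f v δ.clauses,
    fun _ _ h => applyClauses_mono ρ le_rfl h δ.clauses⟩
  monotone' _ _ hf _ := applyClauses_mono ρ hf le_rfl δ.clauses

/-- The semantics `⟦f⟧_ρ : ⟦A⟧ → ⟦B⟧` of a recursive definition of `f : A → B`: the limit of the
iterates of its operator, starting from the least function. -/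
noncomputable def RecDef.sem (δ : RecDef Φ A B) (ρ : Env Φ) : 𝒯.Sem A →o 𝒯.Sem B :=
  OmegaCompletePartialOrder.ωSup
    (OmegaCompletePartialOrder.fixedPoints.iterateChain (δ.operator ρ) ⊥ bot_le)

/-- The sum `T_f` of the terms `u[σ_p]`, for all the clauses `f p = u` of the definition, where
`σ_p` sends each variable of `p` to the term that extracts it from the argument `x`. -/
def RecDef.term (δ : RecDef Φ A B) : Set (Term S Φ.Fn) :=
  {t | ∃ cl ∈ δ.clauses, t = cl.rhs.toTerm (cl.pat.extract .x)}

end Semantics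

end SizeChange

/-!
A value `v` fails to be total exactly when there is a sequence `b` of steps that never leaves the
tree `v` and has no even principal priority (`Val.Bad`, `Val.exists_bad`, `Val.Bad.not_total`). If
`⟦f⟧` is not total, such a sequence can be chased through the recursive calls.

Let `v` be total, with `⟦f⟧ v` bad along `b`. As `⟦f⟧` is a fixed point of its operator
(`RecDef.sem_apply`), `⟦f⟧ v` is the value of the right-hand side of a matching clause. Constructors,
records and destructors pass badness to a subexpression; a function `g` of the environment does so
because it is total; a variable cannot be bad, since it stands for a part of `v`. At a call
`f e`, either the value of `e` is not total, and the chase goes on inside `e`, or it is total, and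
the call is a total argument `w` with `⟦f⟧ w` bad along some `b'`. The occurrence of `f` reached in
this way gives a summand `r` of the call-graph (`RecDef.exists_call_of_bad`).

Iterating this gives an infinite path of the call-graph, with limit `L`. The upper set of values
that represents `L v` contains the branch of `⟦f⟧ v` along `b`, that is, the tree `Val.restrict`
obtained from `⟦f⟧ v` by removing everything outside `b`. Indeed `r`, whose records
have one field, maps approximations of the branch of `⟦f⟧ w` along `b'` to approximations of the
branch of `⟦f⟧ v` along `b`: this is clear if no function name lies above the call, and otherwise
`r` contains `✠` there and evaluates to `⊥`, the argument of `✠` being different from `𝟎`. This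
invariant is stated for an arbitrary monotone interpretation of `f` approximating the last call,
so that it is preserved by one more unfolding (`Term.interp_unfoldWith_le`). As the
branch is bad along `b` (`Val.Bad.restrict`), it is not total, which contradicts the totality of
the path at the total argument `v`.
-/

namespace SizeChange

open Set Filter TypeSystem

variable {S : Signature}

/-! ### Non-total branches -/

namespace Val

theorem prefixOf_succ (b : ℕ → Step S) (k : ℕ) :
    prefixOf b (k + 1) = b 0 :: prefixOf (fun i => b (i + 1)) k := by
  simp [prefixOf, List.range_succ_eq_map, Function.comp_def]

theorem prefixOf_snoc (b : ℕ → Step S) (k : ℕ) : prefixOf b (k + 1) = prefixOf b k ++ [b k] := by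
  simp [prefixOf, List.range_succ]

@[simp] theorem prefixOf_zero (b : ℕ → Step S) : prefixOf b 0 = [] := rfl

@[simp] theorem length_prefixOf (b : ℕ → Step S) (k : ℕ) : (prefixOf b k).length = k := by
  simp [prefixOf]

/-- The sequence `b` of steps witnesses that `v` is not total: it never leaves the tree `v`, and it
has no even principal priority. If `b` reaches a leaf `⊥`, only finitely many of its prefixes are
addresses of nodes, so there is no principal priority at all; thus both ways of failing to be total
are covered. -/
def Bad (v : Val S) (b : ℕ → Step S) : Prop :=
  (∀ k n, v.node (prefixOf b k) = some n → n.Allows (b k)) ∧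
    ∀ p, v.PrincipalPrio b p → ¬ Even p

theorem principalPrio_tail {v : Val S} {b : ℕ → Step S} {p : ℕ} :
    (v.sub (b 0)).PrincipalPrio (fun i => b (i + 1)) p ↔ v.PrincipalPrio b p := by
  simp only [PrincipalPrio, sub_node, ← prefixOf_succ]
  conv_rhs => rw [← Filter.map_add_atTop_eq_nat 1, Filter.frequently_map, Filter.eventually_map]

theorem bad_iff {v : Val S} {b : ℕ → Step S} :
    v.Bad b ↔ (∀ n, v.head = some n → n.Allows (b 0)) ∧
      (v.sub (b 0)).Bad fun i => b (i + 1) := by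
  simp only [Bad, principalPrio_tail, sub_node, ← prefixOf_succ]
  constructor
  · exact fun h => ⟨h.1 0, fun k => h.1 (k + 1), h.2⟩
  · rintro ⟨h₀, h₁, h₂⟩
    refine ⟨fun k => ?_, h₂⟩
    cases k with
    | zero => exact h₀
    | succ k => exact h₁ k

theorem Bad.of_sub {v : Val S} {s : Step S} {b : ℕ → Step S}
    (h₀ : ∀ n, v.head = some n → n.Allows s) (h : (v.sub s).Bad b) :
    v.Bad fun k => Nat.casesOn k s b :=
  bad_iff.2 ⟨h₀, h⟩

theorem Bad.not_total {v : Val S} {b : ℕ → Step S} (h : v.Bad b) : ¬ v.Total := by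
  rintro ⟨ht, hb⟩
  have hsome : ∀ k, v.Reachable (prefixOf b k) := by
    intro k
    induction k with
    | zero => exact .inl rfl
    | succ k ih =>
      obtain ⟨n, hn⟩ := Option.ne_none_iff_exists'.1 (ht _ ih)
      exact .inr ⟨_, _, n, prefixOf_snoc b k, hn, h.1 k n hn⟩
  obtain ⟨p, hp, he⟩ := hb b fun k => by
    obtain ⟨n, hn⟩ := Option.ne_none_iff_exists'.1 (ht _ (hsome k))
    exact ⟨n, hn, h.1 k n hn⟩
  exact h.2 p hp he

theorem node_append_eq_none {v : Val S} {a : List (Step S)} (h : v.node a = none)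
    (l : List (Step S)) : v.node (a ++ l) = none := by
  induction l using List.reverseRecOn with
  | nil => simpa using h
  | append_singleton l s ih =>
    by_contra hn
    rw [← List.append_assoc] at hn
    obtain ⟨n, hn, -⟩ := v.wf _ s hn
    rw [ih] at hn
    cases hn

/-- A reachable leaf `⊥` lies on a bad sequence of steps. -/
theorem exists_bad_of_node_eq_none {v : Val S} {a : List (Step S)} (ha : v.Reachable a)
    (h : v.node a = none) : ∃ b, v.Bad b := by
  induction a generalizing v with
  | nil =>
    have hv := node_eq_none_of_head h
    exact ⟨fun _ => none, fun k n hn => by simp [hv] at hn,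
      fun p hp => by simp [PrincipalPrio, hv] at hp⟩
  | cons s a ih =>
    obtain ha | ⟨a', t, n, ha', hn, hnt⟩ := ha
    · cases ha
    · have hs : ∀ n, v.head = some n → n.Allows s := by
        intro m hm
        rcases a' with _ | ⟨s', a'⟩
        · obtain ⟨rfl, rfl⟩ := List.cons.inj ha'
          rw [show v.node [] = some m from hm] at hn
          cases hn
          exact hnt
        · obtain ⟨rfl, rfl⟩ := List.cons.inj ha'
          by_cases hv : v.node [s] = none
          · have := node_append_eq_none hv a'
            rw [List.singleton_append, hn] at this
            cases this
          · obtain ⟨m', hm', hs⟩ := v.wf [] s hv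
            rw [show v.node [] = some m from hm] at hm'
            cases hm'
            exact hs
      have hr : (v.sub s).Reachable a := by
        rcases a' with _ | ⟨s', a'⟩
        · exact .inl (List.cons.inj ha').2
        · obtain ⟨rfl, rfl⟩ := List.cons.inj ha'
          exact .inr ⟨a', t, n, rfl, hn, hnt⟩
      obtain ⟨b, hb⟩ := ih hr h
      exact ⟨_, hb.of_sub hs⟩

theorem exists_bad {v : Val S} (h : ¬ v.Total) : ∃ b, v.Bad b := by
  by_cases hv : ∀ a, v.Reachable a → v.node a ≠ none
  · have hb : ¬ ∀ b, v.IsBranch b → ∃ p, v.PrincipalPrio b p ∧ Even p := fun hb => h ⟨hv, hb⟩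
    push Not at hb
    obtain ⟨b, hb, hp⟩ := hb
    refine ⟨b, fun k n hn => ?_, fun p h => by simpa using hp p h⟩
    obtain ⟨m, hm, hs⟩ := hb k
    rw [hn] at hm
    cases hm
    exact hs
  · push Not at hv
    obtain ⟨a, ha, hn⟩ := hv
    exact exists_bad_of_node_eq_none ha hn

theorem Total.head_ne_none {v : Val S} (h : v.Total) : v.head ≠ none := h.1 [] (.inl rfl)

theorem Total.sub {v : Val S} (h : v.Total) {n : Node S} (hn : v.head = some n) {s : Step S}
    (hs : n.Allows s) : (v.sub s).Total := by
  by_contra hv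
  obtain ⟨b, hb⟩ := exists_bad hv
  refine (hb.of_sub fun m hm => ?_).not_total h
  rw [hn] at hm
  cases hm
  exact hs

/-- Total values are maximal: no node can be added to them. -/
theorem Total.eq_of_le {u v : Val S} (hu : u.Total) (h : u ≤ v) : v = u := by
  have key : ∀ a n, v.node a = some n → u.node a = some n := by
    intro a
    induction a using List.reverseRecOn with
    | nil =>
      intro n hn
      obtain ⟨m, hm⟩ := Option.ne_none_iff_exists'.1 hu.head_ne_none
      have := h [] m hm
      rw [hn] at this
      cases this
      exact hm
    | append_singleton a s ih =>
      intro n hn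
      obtain ⟨m, hm, hs⟩ := v.wf a s (by simp [hn])
      obtain ⟨n', hn'⟩ := Option.ne_none_iff_exists'.1
        (hu.1 (a ++ [s]) (.inr ⟨a, s, m, rfl, ih m hm, hs⟩))
      have := h _ _ hn'
      rw [hn] at this
      cases this
      exact hn'
  exact le_antisymm key h

end Val

/-! ### Restriction of a value to a branch -/

/-- The label with its outgoing steps restricted to `s`: the fields of a record other than the one
given by `s` are removed. -/
def Node.restrict (s : Step S) : Node S → Node S
  | .con c p => .con c p
  | .record _ p => .record {d | s = some d} p

@[simp] theorem Node.prio_restrict (s : Step S) (n : Node S) : (n.restrict s).prio = n.prio := by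
  cases n <;> rfl

theorem Node.Allows.restrict {s : Step S} {n : Node S} (h : n.Allows s) :
    (n.restrict s).Allows s := by
  cases n with
  | con c p => exact h
  | record ds p =>
    obtain ⟨d, -, rfl⟩ := h
    exact ⟨d, rfl, rfl⟩

namespace Val

open Classical in
/-- The part of `v` along the sequence `b` of steps: every other child of a node is dropped, and
records keep only the field through which `b` passes. This is the shape of the values of the
branches in a call-graph. -/
noncomputable def restrict (v : Val S) (b : ℕ → Step S) : Val S where
  node a := if a = prefixOf b a.length then (v.node a).map (Node.restrict (b a.length)) else none
  wf a s h := by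
    by_cases ha : a ++ [s] = prefixOf b (a ++ [s]).length
    · rw [if_pos ha] at h
      rw [List.length_append, List.length_singleton, prefixOf_snoc] at ha
      obtain ⟨ha', hs⟩ := List.append_inj ha (by simp)
      obtain rfl : s = b a.length := by simpa using hs
      obtain ⟨n, hn, hs⟩ := v.wf a _ fun hn => h (by rw [hn]; rfl)
      exact ⟨n.restrict (b a.length), (if_pos ha').trans (by rw [hn]; rfl), hs.restrict⟩
    · exact absurd (if_neg ha) h

theorem restrict_node_prefixOf (v : Val S) (b : ℕ → Step S) (k : ℕ) :
    (v.restrict b).node (prefixOf b k) = (v.node (prefixOf b k)).map (Node.restrict (b k)) := by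
  simp [restrict]

theorem head_restrict (v : Val S) (b : ℕ → Step S) :
    (v.restrict b).head = v.head.map (Node.restrict (b 0)) :=
  restrict_node_prefixOf v b 0

theorem sub_restrict (v : Val S) (b : ℕ → Step S) :
    (v.restrict b).sub (b 0) = (v.sub (b 0)).restrict fun i => b (i + 1) := by
  ext1
  funext a
  have h : b 0 :: a = prefixOf b (b 0 :: a).length ↔ a = prefixOf (fun i => b (i + 1)) a.length := by
    rw [List.length_cons, prefixOf_succ]
    simp
  by_cases ha : a = prefixOf (fun i => b (i + 1)) a.length
  · exact (if_pos (h.2 ha)).trans (if_pos ha).symm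
  · exact (if_neg (mt h.1 ha)).trans (if_neg ha).symm

theorem Bad.restrict {v : Val S} {b : ℕ → Step S} (h : v.Bad b) : (v.restrict b).Bad b := by
  refine ⟨fun k n hn => ?_, fun p hp => h.2 p ?_⟩
  · rw [restrict_node_prefixOf, Option.map_eq_some_iff] at hn
    obtain ⟨m, hm, rfl⟩ := hn
    exact (h.1 k m hm).restrict
  · simpa [PrincipalPrio, restrict_node_prefixOf, Function.comp_def] using hp

theorem con_le {c : S.Con} {p : OddPrio S} {u v : Val S} (h : v.head = some (.con c p))
    (hu : u ≤ v.sub none) : con c p u ≤ v := by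
  intro a n hn
  rcases a with _ | ⟨_ | d, a⟩
  · exact h.trans hn
  · exact hu a n hn
  · cases hn

theorem record_le {ds : Set S.Des} {p : EvenPrio S} {u : ds → Val S} {v : Val S}
    (h : v.head = some (.record ds p)) (hu : ∀ d : ds, u d ≤ v.sub (some d.1)) :
    record ds p u ≤ v := by
  intro a n hn
  rcases a with _ | ⟨_ | d, a⟩
  · exact h.trans hn
  · cases hn
  · by_cases hd : d ∈ ds
    · simp only [record, dif_pos hd] at hn
      exact hu ⟨d, hd⟩ a n hn
    · simp only [record, dif_neg hd] at hn
      cases hn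

end Val

/-! ### Monotonicity and substitution in the language of operators -/

namespace Apx

theorem ne_zero_of_mem {U : Apx S} {v : Val S} (h : v ∈ U) : U ≠ zero := by
  rintro rfl
  exact h

theorem eq_zero_of_le {U V : Apx S} (h : U ≤ V) (hU : U = zero) : V = zero := by
  subst hU
  exact Apx.ext (subset_empty_iff.1 h)

theorem mem_bot (v : Val S) : v ∈ (bot : Apx S) := trivial

theorem daimon_of_ne_zero {U : Apx S} (h : U ≠ zero) : daimon U = bot := if_neg h

theorem daimon_mono : Monotone (daimon : Apx S → Apx S) := by
  intro U V h
  by_cases hU : U = zero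
  · rw [hU, eq_zero_of_le h hU]
  · rw [daimon_of_ne_zero hU]
    exact fun v _ => mem_bot v

theorem mem_single {v : Val S} : v ∈ single v := le_refl v

theorem total_single {v : Val S} (h : v.Total) : (single v).Total := by
  intro w hw
  rwa [h.eq_of_le hw]

theorem con_mono (c : S.Con) (p : OddPrio S) : Monotone (con c p) :=
  fun _ _ h _ ⟨u, hu, hw⟩ => ⟨u, h hu, hw⟩

theorem record_mono (ds : Set S.Des) (p : EvenPrio S) : Monotone (record ds p) :=
  fun _ _ h _ ⟨u, hu, hw⟩ => ⟨u, fun d => h d (hu d), hw⟩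

theorem conInv_mono (c : S.Con) (p : OddPrio S) : Monotone (conInv c p) :=
  fun _ _ h _ ⟨u, hu, hw⟩ => ⟨u, h hu, hw⟩

theorem proj_mono (d : S.Des) (p : EvenPrio S) : Monotone (proj d p) :=
  fun _ _ h _ ⟨u, hu, hw⟩ => ⟨u, h hu, hw⟩

theorem conInv_mem {c : S.Con} {p : OddPrio S} {U : Apx S} {v : Val S} (hv : v ∈ U)
    (h : v.head = some (.con c p)) : v.sub none ∈ conInv c p U :=
  ⟨v, hv, v.sub none, by simp [Val.conInv, h], le_rfl⟩

theorem proj_mem {d : S.Des} {p : EvenPrio S} {U : Apx S} {v : Val S} (hv : v ∈ U)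
    (h : ∀ n, v.head = some n → ∃ ds, d ∈ ds ∧ n = .record ds p) :
    v.sub (some d) ∈ proj d p U := by
  refine ⟨v, hv, v.sub (some d), ?_, le_rfl⟩
  rcases hn : v.head with _ | n
  · rw [Val.eq_bot_of_head hn]
    rfl
  · simp only [Val.proj, hn, if_pos (h n hn)]
    rfl

end Apx

namespace Term

variable {Fn : Type} {ρ : Fn → Apx S → Apx S} {h : Apx S → Apx S}

theorem interp_mono (hρ : ∀ g, Monotone (ρ g)) (hh : Monotone h) (t : Term S Fn) :
    Monotone (interp ρ h t) := by
  intro U V hUV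
  induction t with
  | con c p t ih => exact Apx.con_mono c p ih
  | record ds p t ih => exact Apx.record_mono ds p ih
  | conInv c p t ih => exact Apx.conInv_mono c p ih
  | proj d p t ih => exact Apx.proj_mono d p ih
  | x => exact hUV
  | daimon n θ ih =>
    simp only [interp]
    split_ifs with h₁ h₂ h₂
    · exact le_rfl
    · obtain ⟨i, hi⟩ := h₁
      exact absurd ⟨i, Apx.eq_zero_of_le (ih i) hi⟩ h₂
    · exact fun _ hv => hv.elim
    · exact Apx.daimon_mono hUV
  | call t ih => exact hh ih
  | fn g t ih => exact hρ g ih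
  | zero => exact le_rfl

theorem mem_interp_daimon₁ {U : Apx S} {t : Term S Fn} {u v : Val S} (hu : u ∈ U)
    (hv : v ∈ interp ρ h t U) (w : Val S) : w ∈ interp ρ h (daimon₁ t) U := by
  simp only [daimon₁, interp]
  rw [if_neg fun ⟨_, hi⟩ => Apx.ne_zero_of_mem hv hi,
    Apx.daimon_of_ne_zero (Apx.ne_zero_of_mem hu)]
  exact Apx.mem_bot w

/-- Substitution of terms is bounded by composition. The inequality can be strict, because `✠ ∅`
detects whether its argument is `𝟎`. -/
theorem interp_subst_le (hρ : ∀ g, Monotone (ρ g)) (hh : Monotone h) {U : Apx S}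
    (hU : U ≠ Apx.zero) (r t : Term S Fn) :
    interp ρ h (subst r t) U ≤ interp ρ h t (interp ρ h r U) := by
  induction t with
  | con c p t ih => exact Apx.con_mono c p ih
  | record ds p t ih => exact Apx.record_mono ds p ih
  | conInv c p t ih => exact Apx.conInv_mono c p ih
  | proj d p t ih => exact Apx.proj_mono d p ih
  | x => exact le_rfl
  | daimon n θ ih =>
    simp only [subst, interp]
    split_ifs with h₁ h₂ h₂
    · exact le_rfl
    · obtain ⟨i, hi⟩ := h₁
      exact absurd ⟨i, Apx.eq_zero_of_le (ih i) hi⟩ h₂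
    · exact fun _ hv => hv.elim
    · rw [Apx.daimon_of_ne_zero hU]
      exact fun v _ => Apx.mem_bot v
  | call t ih => exact hh ih
  | fn g t ih => exact hρ g ih
  | zero => exact le_rfl

/-- Replacement of all the occurrences of `f` by the same term `r`. -/
def unfoldWith (r : Term S Fn) : Term S Fn → Term S Fn
  | con c p t => con c p (unfoldWith r t)
  | record ds p t => record ds p fun d => unfoldWith r (t d)
  | conInv c p t => conInv c p (unfoldWith r t)
  | proj d p t => proj d p (unfoldWith r t)
  | x => x
  | daimon n θ => daimon n fun i => unfoldWith r (θ i)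
  | call t => subst (unfoldWith r t) r
  | fn g t => fn g (unfoldWith r t)
  | zero => zero

theorem unfolds_unfoldWith {T : Set (Term S Fn)} {r : Term S Fn} (hr : r ∈ T) (t : Term S Fn) :
    Unfolds T t (unfoldWith r t) := by
  induction t with
  | con c p t ih => exact .con c p ih
  | record ds p t ih => exact .record ds p ih
  | conInv c p t ih => exact .conInv c p ih
  | proj d p t ih => exact .proj d p ih
  | x => exact .x
  | daimon n θ ih => exact .daimon n ih
  | call t ih => exact .call hr ih
  | fn g t ih => exact .fn g ih
  | zero => exact .zero

theorem HasCall.subst {r t : Term S Fn} (ht : HasCall t) : HasCall (subst r t) := by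
  induction t with
  | con c p t ih => exact ih ht
  | record ds p t ih => exact ht.imp ih
  | conInv c p t ih => exact ih ht
  | proj d p t ih => exact ih ht
  | x => exact ht.elim
  | daimon n θ ih => exact ht.imp ih
  | call t ih => trivial
  | fn g t ih => exact ih ht
  | zero => exact ht.elim

theorem HasCall.unfoldWith {r t : Term S Fn} (hr : HasCall r) (ht : HasCall t) :
    HasCall (unfoldWith r t) := by
  induction t with
  | con c p t ih => exact ih ht
  | record ds p t ih => exact ht.imp ih
  | conInv c p t ih => exact ih ht
  | proj d p t ih => exact ih ht
  | x => exact ht.elim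
  | daimon n θ ih => exact ht.imp ih
  | call t ih => exact hr.subst
  | fn g t ih => exact ih ht
  | zero => exact ht.elim

/-- Unfolding `f` in `s` is bounded by interpreting `f` in `s` by the unfolding. -/
theorem interp_unfoldWith_le (hρ : ∀ g, Monotone (ρ g)) (hh : Monotone h) {U : Apx S}
    (hU : U ≠ Apx.zero) (r s : Term S Fn) :
    interp ρ h (unfoldWith r s) U ≤ interp ρ (interp ρ h r) s U := by
  induction s with
  | con c p t ih => exact Apx.con_mono c p ih
  | record ds p t ih => exact Apx.record_mono ds p ih
  | conInv c p t ih => exact Apx.conInv_mono c p ih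
  | proj d p t ih => exact Apx.proj_mono d p ih
  | x => exact le_rfl
  | daimon n θ ih =>
    simp only [unfoldWith, interp]
    split_ifs with h₁ h₂ h₂
    · exact le_rfl
    · obtain ⟨i, hi⟩ := h₁
      exact absurd ⟨i, Apx.eq_zero_of_le (ih i) hi⟩ h₂
    · exact fun _ hv => hv.elim
    · exact le_rfl
  | call t ih => exact (interp_subst_le hρ hh hU _ r).trans (interp_mono hρ hh r ih)
  | fn g t ih => exact hρ g ih
  | zero => exact le_rfl

theorem hasCall_of_mem_callGraph {t : Term S Fn} {r : Term S Empty} (hr : r ∈ callGraph t) :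
    HasCall r := by
  induction t generalizing r with
  | con c p t ih =>
    obtain ⟨r, hr', rfl⟩ := hr
    exact (ih hr' :)
  | record ds p t ih =>
    obtain ⟨d, r, hr', rfl⟩ := mem_iUnion.1 hr
    exact ⟨⟨d.1, rfl⟩, ih d hr'⟩
  | conInv c p t ih =>
    obtain ⟨r, hr', rfl⟩ := hr
    exact (ih hr' :)
  | proj d p t ih =>
    obtain ⟨r, hr', rfl⟩ := hr
    exact (ih hr' :)
  | x => exact hr.elim
  | daimon n θ ih =>
    obtain ⟨i, r, hr', rfl⟩ := mem_iUnion.1 hr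
    exact ⟨0, ih i hr'⟩
  | call t ih =>
    obtain rfl | ⟨r, hr', rfl⟩ := hr
    · trivial
    · exact ⟨0, ih hr'⟩
  | fn g t ih =>
    obtain ⟨r, hr', rfl⟩ := hr
    exact ⟨0, ih hr'⟩
  | zero => exact hr.elim

end Term

/-! ### The semantics is a fixed point -/

namespace TypeSystem.Sem

variable {𝒯 : TypeSystem S} {A B : 𝒯.Ty}

/-- The value `z` is the limit of the chain `Z`, expressed with nodes. -/
def Lim (Z : ℕ → 𝒯.Sem A) (z : 𝒯.Sem A) : Prop :=
  Monotone Z ∧ ∀ a n, z.1.node a = some n ↔ ∃ k, (Z k).1.node a = some n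

theorem Lim.le {Z : ℕ → 𝒯.Sem A} {z : 𝒯.Sem A} (h : Lim Z z) (k : ℕ) : Z k ≤ z :=
  fun a n hn => (h.2 a n).2 ⟨k, hn⟩

theorem lim_const (z : 𝒯.Sem A) : Lim (fun _ => z) z :=
  ⟨monotone_const, fun _ _ => by simp⟩

theorem lim_ωSup (c : OmegaCompletePartialOrder.Chain (𝒯.Sem A)) :
    Lim c (OmegaCompletePartialOrder.ωSup c) :=
  ⟨c.monotone, fun a n => Val.ωSup_node _ a n⟩

theorem Lim.isLUB {Z : ℕ → 𝒯.Sem A} {z : 𝒯.Sem A} (h : Lim Z z) : IsLUB (range Z) z := by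
  refine ⟨by rintro _ ⟨k, rfl⟩; exact h.le k, fun w hw a n hn => ?_⟩
  obtain ⟨k, hk⟩ := (h.2 a n).1 hn
  exact hw ⟨k, rfl⟩ a n hk

theorem lim_of_isLUB {Z : ℕ → 𝒯.Sem A} {z : 𝒯.Sem A} (hZ : Monotone Z) (h : IsLUB (range Z) z) :
    Lim Z z := by
  have hc := lim_ωSup (⟨Z, hZ⟩ : OmegaCompletePartialOrder.Chain (𝒯.Sem A))
  rw [h.unique hc.isLUB]
  exact hc

/-- A limit does not depend on the first term of the chain. -/
theorem Lim.eq_of_succ {Z : ℕ → 𝒯.Sem A} {z w : 𝒯.Sem A} (hz : Lim Z z)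
    (hw : Lim (fun k => Z (k + 1)) w) : z = w := by
  refine le_antisymm (fun a n hn => ?_) fun a n hn => ?_
  · obtain ⟨k, hk⟩ := (hz.2 a n).1 hn
    exact (hw.2 a n).2 ⟨k, hz.1 k.le_succ a n hk⟩
  · obtain ⟨k, hk⟩ := (hw.2 a n).1 hn
    exact (hz.2 a n).2 ⟨k + 1, hk⟩

theorem Lim.congr {Z W : ℕ → 𝒯.Sem A} {z : 𝒯.Sem A} (hz : Lim Z z) (hW : Monotone W) (K : ℕ)
    (h : ∀ k, K ≤ k → W k = Z k) : Lim W z := by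
  refine ⟨hW, fun a n => (hz.2 a n).trans ⟨fun ⟨k, hk⟩ => ?_, fun ⟨k, hk⟩ => ?_⟩⟩
  · refine ⟨max k K, ?_⟩
    rw [h _ (le_max_right _ _)]
    exact hz.1 (le_max_left k K) a n hk
  · refine ⟨max k K, ?_⟩
    rw [← h _ (le_max_right _ _)]
    exact hW (le_max_left k K) a n hk

theorem Lim.map_scott {g : 𝒯.Sem A → 𝒯.Sem B} (hg : ScottContinuous g) {Z : ℕ → 𝒯.Sem A}
    {z : 𝒯.Sem A} (h : Lim Z z) : Lim (fun k => g (Z k)) (g z) := by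
  refine lim_of_isLUB (hg.monotone.comp h.1) ?_
  have := hg (range_nonempty Z) h.1.directed_le.directedOn_range h.isLUB
  rwa [← range_comp] at this

theorem Lim.exists_head {Z : ℕ → 𝒯.Sem A} {z : 𝒯.Sem A} (h : Lim Z z) (hz : z.1.head ≠ none) :
    ∃ k, (Z k).1.head = z.1.head := by
  obtain ⟨n, hn⟩ := Option.ne_none_iff_exists'.1 hz
  obtain ⟨k, hk⟩ := (h.2 [] n).1 hn
  exact ⟨k, hk.trans hn.symm⟩

theorem lim_con (D : 𝒯.Data) (c : 𝒯.cons D) {Z : ℕ → 𝒯.Sem (𝒯.arg D c)} {z : 𝒯.Sem (𝒯.arg D c)}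
    (h : Lim Z z) : Lim (fun k => con D c (Z k)) (con D c z) := by
  refine ⟨fun i j hij => Val.con_mono _ _ (h.1 hij), fun a n => ?_⟩
  rcases a with _ | ⟨_ | d, a⟩
  · simp [con, Val.con]
  · exact h.2 a n
  · simp [con, Val.con]

theorem lim_record (D : 𝒯.Codata) {Z : ℕ → ∀ d, 𝒯.Sem (𝒯.res D d)} {z : ∀ d, 𝒯.Sem (𝒯.res D d)}
    (h : ∀ d, Lim (fun k => Z k d) (z d)) : Lim (fun k => record D (Z k)) (record D z) := by
  refine ⟨fun i j hij => Val.record_mono _ _ fun d => (h d).1 hij, fun a n => ?_⟩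
  rcases a with _ | ⟨_ | d, a⟩
  · simp [record, Val.record]
  · simp [record, Val.record]
  · by_cases hd : d ∈ 𝒯.fields D
    · simp only [record, Val.record, dif_pos hd]
      exact (h ⟨d, hd⟩).2 a n
    · simp [record, Val.record, dif_neg hd]

theorem lim_proj (D : 𝒯.Codata) (d : 𝒯.fields D) {Z : ℕ → 𝒯.Sem (.inr D)} {z : 𝒯.Sem (.inr D)}
    (h : Lim Z z) : Lim (fun k => proj D d (Z k)) (proj D d z) :=
  ⟨fun _ _ hij => proj_mono D d (h.1 hij), fun a n => h.2 (some d.1 :: a) n⟩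

theorem unCon_val {D : 𝒯.Data} {c : 𝒯.cons D} {v : 𝒯.Sem (.inl D)}
    (hv : v.1.head = some (.con c.1 (𝒯.dataPrio D))) : (unCon D c v).1 = v.1.sub none := by
  rw [unCon, dif_pos hv]

theorem lim_unCon (D : 𝒯.Data) (c : 𝒯.cons D) {Z : ℕ → 𝒯.Sem (.inl D)} {z : 𝒯.Sem (.inl D)}
    (h : Lim Z z) : Lim (fun k => unCon D c (Z k)) (unCon D c z) := by
  have hm : Monotone fun k => unCon D c (Z k) := fun _ _ hij => unCon_mono D c (h.1 hij)
  refine ⟨hm, fun a n => ⟨fun hn => ?_, fun ⟨k, hk⟩ => unCon_mono D c (h.le k) a n hk⟩⟩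
  by_cases hz : z.1.head = some (.con c.1 (𝒯.dataPrio D))
  · obtain ⟨k, hk⟩ := h.exists_head (by simp [hz])
    rw [unCon_val hz] at hn
    obtain ⟨l, hl⟩ := (h.2 _ n).1 hn
    refine ⟨max k l, ?_⟩
    rw [unCon_val (h.1 (le_max_left k l) [] _ (hk.trans hz))]
    exact h.1 (le_max_right k l) _ n hl
  · rw [unCon, dif_neg hz] at hn
    cases hn

theorem head_inr {D : 𝒯.Codata} {v : 𝒯.Sem (.inr D)} {n : Node S} (hn : v.1.head = some n) :
    n = .record (𝒯.fields D) (𝒯.codataPrio D) := by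
  rcases hasType_iff.1 v.2 with h | ⟨h, -⟩
  · simp [hn] at h
  · simpa [hn] using h

theorem Total.unCon {D : 𝒯.Data} {c : 𝒯.cons D} {v : 𝒯.Sem (.inl D)} (h : v.Total)
    (hv : v.1.head = some (.con c.1 (𝒯.dataPrio D))) : (unCon D c v).Total := by
  rw [Sem.Total, unCon_val hv]
  exact Val.Total.sub h hv rfl

theorem Total.proj {D : 𝒯.Codata} (d : 𝒯.fields D) {v : 𝒯.Sem (.inr D)} (h : v.Total) :
    (proj D d v).Total := by
  obtain ⟨n, hn⟩ := Option.ne_none_iff_exists'.1 (Val.Total.head_ne_none h)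
  refine Val.Total.sub h hn ?_
  rw [head_inr hn]
  exact ⟨d.1, d.2, rfl⟩

end TypeSystem.Sem

open TypeSystem.Sem

variable {𝒯 : TypeSystem S} {Φ : FunSig 𝒯} {A B : 𝒯.Ty}

namespace Pat

theorem Matches.exists_of_lim {A : 𝒯.Ty} {q : Pat 𝒯 A} {Z : ℕ → 𝒯.Sem A} {z : 𝒯.Sem A}
    (h : Lim Z z) (hz : q.Matches z) : ∃ k, q.Matches (Z k) := by
  induction q with
  | var => exact ⟨0, trivial⟩
  | con D c q ih =>
    obtain ⟨k, hk⟩ := h.exists_head (by simp [hz.1])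
    obtain ⟨l, hl⟩ := ih (lim_unCon D c h) hz.2
    exact ⟨max k l, h.1 (le_max_left k l) [] _ (hk.trans hz.1),
      hl.mono (unCon_mono D c (h.1 (le_max_right k l)))⟩
  | record D q ih =>
    obtain ⟨k, hk⟩ := h.exists_head hz.1
    choose l hl using fun d => ih d (lim_proj D d h) (hz.2 d)
    -- there are finitely many fields, so that all of them match from some rank on
    have := S.finite_des
    obtain ⟨L, hL⟩ := (finite_range l).bddAbove
    refine ⟨max k L, head_ne_none (h.1 (le_max_left k L)) (by rw [hk]; exact hz.1), fun d => ?_⟩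
    exact (hl d).mono (proj_mono D d (h.1 ((hL ⟨d, rfl⟩).trans (le_max_right k L))))

theorem Fails.exists_of_lim {A : 𝒯.Ty} {q : Pat 𝒯 A} {Z : ℕ → 𝒯.Sem A} {z : 𝒯.Sem A}
    (h : Lim Z z) (hz : q.Fails z) : ∃ k, q.Fails (Z k) := by
  induction q with
  | var => exact hz.elim
  | con D c q ih =>
    obtain ⟨k, hk⟩ := h.exists_head hz.1
    by_cases hc : z.1.head = some (.con c.1 (𝒯.dataPrio D))
    · obtain ⟨l, hl⟩ := ih (lim_unCon D c h) (hz.2 hc)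
      exact ⟨max k l, head_ne_none (h.1 (le_max_left k l)) (by rw [hk]; exact hz.1),
        fun _ => hl.mono (unCon_mono D c (h.1 (le_max_right k l)))⟩
    · exact ⟨k, by rw [hk]; exact hz.1, fun hk' => absurd (hk.symm.trans hk') hc⟩
  | record D q ih =>
    obtain ⟨k, hk⟩ := h.exists_head hz.1
    obtain ⟨d, hd⟩ := hz.2
    obtain ⟨l, hl⟩ := ih d (lim_proj D d h) hd
    exact ⟨max k l, head_ne_none (h.1 (le_max_left k l)) (by rw [hk]; exact hz.1), d,
      hl.mono (proj_mono D d (h.1 (le_max_right k l)))⟩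

theorem lim_unifier {A : 𝒯.Ty} (q : Pat 𝒯 A) {Z : ℕ → 𝒯.Sem A} {z : 𝒯.Sem A}
    (h : Lim Z z) (y : q.Var) : Lim (fun k => q.unifier (Z k) y) (q.unifier z y) := by
  induction q with
  | var => exact h
  | con D c q ih => exact ih (lim_unCon D c h) y
  | record D q ih => exact ih y.1 (lim_proj D y.1 h) y.2

theorem fails_of_not_matches {A : 𝒯.Ty} {q : Pat 𝒯 A} {v : 𝒯.Sem A} (hv : v.Total)
    (h : ¬ q.Matches v) : q.Fails v := by
  have hne := Val.Total.head_ne_none hv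
  induction q with
  | var => exact absurd trivial h
  | con D c q ih =>
    refine ⟨hne, fun hc => ?_⟩
    have ht := hv.unCon hc
    exact ih ht (fun hm => h ⟨hc, hm⟩) (Val.Total.head_ne_none ht)
  | record D q ih =>
    refine ⟨hne, ?_⟩
    by_contra hd
    refine h ⟨hne, fun d => ?_⟩
    by_contra hm
    exact hd ⟨d, ih d (hv.proj d) hm (Val.Total.head_ne_none (hv.proj d))⟩

theorem total_unifier {A : 𝒯.Ty} {q : Pat 𝒯 A} {v : 𝒯.Sem A} (hv : v.Total)
    (h : q.Matches v) (y : q.Var) : (q.unifier v y).Total := by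
  induction q with
  | var => exact hv
  | con D c q ih => exact ih (hv.unCon h.1) h.2 y
  | record D q ih => exact ih y.1 (hv.proj y.1) (h.2 y.1) y.2

/-- The terms `σ_p` compute the values of the variables of the pattern. -/
theorem unifier_mem_extract {Fn : Type} {ρ : Empty → Apx S → Apx S} {h : Apx S → Apx S}
    {U : Apx S} {A : 𝒯.Ty} {q : Pat 𝒯 A} {v : 𝒯.Sem A} {t : Term S Fn}
    (ht : v.1 ∈ t.daimonize.interp ρ h U) (hv : q.Matches v) (y : q.Var) :
    (q.unifier v y).1 ∈ (q.extract t y).daimonize.interp ρ h U := by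
  induction q generalizing t with
  | var => exact ht
  | con D c q ih =>
    refine ih (t := .conInv c.1 (𝒯.dataPrio D) t) ?_ hv.2 y
    rw [unCon_val hv.1]
    exact Apx.conInv_mem ht hv.1
  | record D q ih =>
    refine ih y.1 (t := .proj y.1.1 (𝒯.codataPrio D) t) ?_ (hv.2 y.1) y.2
    exact Apx.proj_mem ht fun n hn => ⟨_, y.1.2, head_inr hn⟩

end Pat

theorem Expr.lim_eval {V : Type} {τ : V → 𝒯.Ty} (ρ : Env Φ) {F : ℕ → 𝒯.Sem A → 𝒯.Sem B}
    {f : 𝒯.Sem A → 𝒯.Sem B} (hf : ∀ Z z, Lim Z z → Lim (fun k => F k (Z k)) (f z))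
    {σ : ℕ → ∀ y, 𝒯.Sem (τ y)} {σ' : ∀ y, 𝒯.Sem (τ y)}
    (hσ : ∀ y, Lim (fun k => σ k y) (σ' y)) {C : 𝒯.Ty} (e : Expr Φ A B τ C) :
    Lim (fun k => e.eval ρ (F k) (σ k)) (e.eval ρ f σ') := by
  induction e with
  | var y => exact hσ y
  | con D c e ih => exact lim_con D c ih
  | record D e ih => exact lim_record D ih
  | proj D d e ih => exact lim_proj D d ih
  | call e ih => exact hf _ _ ih
  | fn g e ih => exact ih.map_scott (ρ.continuous g)

theorem lim_applyClauses (ρ : Env Φ) {F : ℕ → 𝒯.Sem A →o 𝒯.Sem B} (hF : Monotone F)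
    {f : 𝒯.Sem A → 𝒯.Sem B} (hf : ∀ Z z, Lim Z z → Lim (fun k => F k (Z k)) (f z))
    {Z : ℕ → 𝒯.Sem A} {z : 𝒯.Sem A} (hz : Lim Z z) (l : List (Clause Φ A B)) :
    Lim (fun k => applyClauses ρ (F k) (Z k) l) (applyClauses ρ f z l) := by
  have hmono : ∀ l, Monotone fun k => applyClauses ρ (F k) (Z k) l :=
    fun l i j hij => applyClauses_mono ρ (hF hij) (hz.1 hij) l
  induction l with
  | nil => exact lim_const ⊥
  | cons cl l ih =>
    by_cases hm : cl.pat.Matches z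
    · obtain ⟨K, hK⟩ := hm.exists_of_lim hz
      rw [applyClauses, if_pos hm]
      refine (cl.rhs.lim_eval ρ hf fun y => cl.pat.lim_unifier hz y).congr (hmono _) K
        fun k hk => ?_
      rw [applyClauses, if_pos (hK.mono (hz.1 hk))]
    · have hm' : ∀ k, ¬ cl.pat.Matches (Z k) := fun k h => hm (h.mono (hz.le k))
      by_cases hfl : cl.pat.Fails z
      · obtain ⟨K, hK⟩ := hfl.exists_of_lim hz
        rw [applyClauses, if_neg hm, if_pos hfl]
        refine ih.congr (hmono _) K fun k hk => ?_
        rw [applyClauses, if_neg (hm' k), if_pos (hK.mono (hz.1 hk))]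
      · have hf' : ∀ k, ¬ cl.pat.Fails (Z k) := fun k h => hfl (h.mono (hz.le k))
        simp only [applyClauses, if_neg hm, if_neg hfl, if_neg (hm' _), if_neg (hf' _)]
        exact lim_const ⊥

/-- The iterates `Θ_f^n(⊥)`. -/
noncomputable def RecDef.iter (δ : RecDef Φ A B) (ρ : Env Φ) :
    OmegaCompletePartialOrder.Chain (𝒯.Sem A →o 𝒯.Sem B) :=
  OmegaCompletePartialOrder.fixedPoints.iterateChain (δ.operator ρ) ⊥ bot_le

theorem RecDef.iter_succ (δ : RecDef Φ A B) (ρ : Env Φ) (k : ℕ) (v : 𝒯.Sem A) :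
    δ.iter ρ (k + 1) v = applyClauses ρ (δ.iter ρ k) v δ.clauses :=
  congrArg (fun f : 𝒯.Sem A →o 𝒯.Sem B => f v)
    (Function.iterate_succ_apply' (δ.operator ρ) k ⊥)

theorem RecDef.lim_iter_apply (δ : RecDef Φ A B) (ρ : Env Φ) (m : ℕ) {Z : ℕ → 𝒯.Sem A}
    {z : 𝒯.Sem A} (h : Lim Z z) : Lim (fun k => δ.iter ρ m (Z k)) (δ.iter ρ m z) := by
  induction m generalizing Z z with
  | zero => exact lim_const ⊥
  | succ m ih =>
    simp only [δ.iter_succ]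
    exact lim_applyClauses ρ (F := fun _ => δ.iter ρ m) monotone_const (fun _ _ => ih) h _

theorem RecDef.lim_iter (δ : RecDef Φ A B) (ρ : Env Φ) (v : 𝒯.Sem A) :
    Lim (fun k => δ.iter ρ k v) (δ.sem ρ v) :=
  lim_ωSup ((δ.iter ρ).map ⟨fun f : 𝒯.Sem A →o 𝒯.Sem B => f v, fun _ _ h => h v⟩)

theorem RecDef.lim_sem (δ : RecDef Φ A B) (ρ : Env Φ) {Z : ℕ → 𝒯.Sem A} {z : 𝒯.Sem A}
    (h : Lim Z z) : Lim (fun k => δ.iter ρ k (Z k)) (δ.sem ρ z) := by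
  have hm : ∀ {i j : ℕ}, i ≤ j → δ.iter ρ i (Z i) ≤ δ.iter ρ j (Z j) := fun {i j} hij =>
    ((δ.iter ρ i).monotone (h.1 hij)).trans ((δ.iter ρ).monotone hij _)
  refine ⟨fun i j hij => hm hij, fun a n => ⟨fun hn => ?_, fun ⟨k, hk⟩ => ?_⟩⟩
  · obtain ⟨k, hk⟩ := ((δ.lim_iter ρ z).2 a n).1 hn
    obtain ⟨l, hl⟩ := ((δ.lim_iter_apply ρ k h).2 a n).1 hk
    exact ⟨max k l, (((δ.iter ρ k).monotone (h.1 (le_max_right k l))).trans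
      ((δ.iter ρ).monotone (le_max_left k l) _)) a n hl⟩
  · exact ((δ.lim_iter ρ z).2 a n).2 ⟨k, (δ.iter ρ k).monotone (h.le k) a n hk⟩

/-- The semantics of a recursive definition satisfies the definition. -/
theorem RecDef.sem_apply (δ : RecDef Φ A B) (ρ : Env Φ) (v : 𝒯.Sem A) :
    δ.sem ρ v = applyClauses ρ (δ.sem ρ) v δ.clauses := by
  refine (δ.lim_iter ρ v).eq_of_succ ?_
  simp only [δ.iter_succ]
  exact lim_applyClauses ρ (δ.iter ρ).monotone (fun _ _ => δ.lim_sem ρ) (lim_const v) _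

/-- On a total argument, one of the matching clauses is selected. -/
theorem exists_clause_of_total (ρ : Env Φ) (f : 𝒯.Sem A → 𝒯.Sem B) {v : 𝒯.Sem A} (hv : v.Total)
    {l : List (Clause Φ A B)} (h : ∃ cl ∈ l, cl.pat.Matches v) :
    ∃ cl ∈ l, cl.pat.Matches v ∧
      applyClauses ρ f v l = cl.rhs.eval ρ f (cl.pat.unifier v) := by
  induction l with
  | nil => simp at h
  | cons cl l ih =>
    by_cases hm : cl.pat.Matches v
    · exact ⟨cl, List.mem_cons_self, hm, by rw [applyClauses, if_pos hm]⟩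
    · obtain ⟨cl', hcl', hm'⟩ := h
      obtain rfl | hl := List.mem_cons.1 hcl'
      · exact absurd hm' hm
      · obtain ⟨cl'', hcl'', hm'', he⟩ := ih ⟨cl', hl, hm'⟩
        refine ⟨cl'', List.mem_cons_of_mem _ hcl'', hm'', ?_⟩
        rw [applyClauses, if_neg hm, if_pos (Pat.fails_of_not_matches hv hm), he]

/-! ### Non-total values come from non-total recursive calls -/

/-- The operators `t^✠` approximate the values of expressions from below. -/
theorem Expr.eval_mem_daimonize {V : Type} {τ : V → 𝒯.Ty} (ρ : Env Φ) (f : 𝒯.Sem A → 𝒯.Sem B)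
    {σ : ∀ y, 𝒯.Sem (τ y)} {θ : V → Term S Φ.Fn} {ρ' : Empty → Apx S → Apx S}
    {h : Apx S → Apx S} {U : Apx S} {v : Val S} (hU : v ∈ U)
    (hθ : ∀ y, (σ y).1 ∈ (θ y).daimonize.interp ρ' h U) {C : 𝒯.Ty} (e : Expr Φ A B τ C) :
    (e.eval ρ f σ).1 ∈ (e.toTerm θ).daimonize.interp ρ' h U := by
  induction e with
  | var y => exact hθ y
  | con D c e ih => exact ⟨_, ih, le_rfl⟩
  | record D e ih => exact ⟨_, ih, le_rfl⟩
  | proj D d e ih => exact Apx.proj_mem ih fun n hn => ⟨_, d.2, head_inr hn⟩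
  | call e ih => exact Term.mem_interp_daimon₁ hU ih _
  | fn g e ih => exact Term.mem_interp_daimon₁ hU ih _

/-- If the value of an expression is not total along `b`, then some occurrence of `f` in it is
applied to a total argument `w` with a non-total result, bad along some `b'`. The summand of the
call-graph for this occurrence turns (approximations of) the restriction of this result to `b'` into
approximations of the restriction of the value to `b`. -/
theorem Expr.exists_call_of_bad {V : Type} {τ : V → 𝒯.Ty} {ρ : Env Φ} (hρ : ρ.Total)
    (f : 𝒯.Sem A → 𝒯.Sem B) {σ : ∀ y, 𝒯.Sem (τ y)} (hσ : ∀ y, (σ y).Total)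
    {θ : V → Term S Φ.Fn} {ρ' : Empty → Apx S → Apx S} {v : Val S}
    (hθ : ∀ (h : Apx S → Apx S) (U : Apx S), v ∈ U →
      ∀ y, (σ y).1 ∈ (θ y).daimonize.interp ρ' h U)
    {C : 𝒯.Ty} (e : Expr Φ A B τ C) {b : ℕ → SizeChange.Step S} (hb : (e.eval ρ f σ).1.Bad b) :
    ∃ r ∈ (e.toTerm θ).callGraph, ∃ w : 𝒯.Sem A, w.Total ∧ ∃ b', (f w).1.Bad b' ∧
      ∀ h : Apx S → Apx S, (∀ U, w.1 ∈ U → (f w).1.restrict b' ∈ h U) →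
        ∀ U, v ∈ U → (e.eval ρ f σ).1.restrict b ∈ r.interp ρ' h U := by
  induction e generalizing b with
  | var y => exact absurd (hσ y) hb.not_total
  | con D c e ih =>
    obtain ⟨h₀, h₁⟩ := Val.bad_iff.1 hb
    have hs : b 0 = none := h₀ _ rfl
    rw [hs] at h₁
    obtain ⟨r, hr, w, hw, b', hb', H⟩ := ih h₁
    refine ⟨_, mem_image_of_mem _ hr, w, hw, b', hb', fun h hh U hU => ⟨_, H h hh U hU, ?_⟩⟩
    refine Val.con_le (Val.head_restrict _ b) ?_
    have := Val.sub_restrict (Expr.eval ρ f σ (.con D c e)).1 b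
    rw [hs] at this
    exact this.ge
  | record D e ih =>
    obtain ⟨h₀, h₁⟩ := Val.bad_iff.1 hb
    obtain ⟨d, hd, hs⟩ := h₀ _ rfl
    have hsub : ((Expr.record D e).eval ρ f σ).1.sub (b 0) = ((e ⟨d, hd⟩).eval ρ f σ).1 := by
      rw [hs]
      exact Val.sub_record _ _ (fun d => ((e d).eval ρ f σ).1) ⟨d, hd⟩
    rw [hsub] at h₁
    obtain ⟨r, hr, w, hw, b', hb', H⟩ := ih ⟨d, hd⟩ h₁
    refine ⟨_, mem_iUnion.2 ⟨⟨d, hd⟩, mem_image_of_mem _ hr⟩, w, hw, b', hb',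
      fun h hh U hU => ⟨_, fun _ => H h hh U hU, ?_⟩⟩
    refine Val.record_le ?_ ?_
    · rw [Val.head_restrict, hs]
      change some (Node.record _ _) = some (Node.record _ _)
      congr 2
      ext d'
      simp [eq_comm]
    · rintro ⟨d', hd'⟩
      rw [show some d' = b 0 from hs ▸ congrArg some hd', Val.sub_restrict, hsub]
  | proj D d e ih =>
    have h₀ : ∀ n, (e.eval ρ f σ).1.head = some n → n.Allows (some d.1) := by
      intro n hn
      rw [head_inr hn]
      exact ⟨d.1, d.2, rfl⟩
    obtain ⟨r, hr, w, hw, b', hb', H⟩ := ih (hb.of_sub h₀)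
    refine ⟨_, mem_image_of_mem _ hr, w, hw, b', hb', fun h hh U hU => ?_⟩
    have hm := Apx.proj_mem (d := d.1) (p := 𝒯.codataPrio D) (H h hh U hU) fun n hn => by
      rw [Val.head_restrict, Option.map_eq_some_iff] at hn
      obtain ⟨m, hm, rfl⟩ := hn
      rw [head_inr hm]
      exact ⟨{d' | some d.1 = some d'}, rfl, rfl⟩
    exact Val.sub_restrict (e.eval ρ f σ).1 (fun k => Nat.casesOn k (some d.1) b) ▸ hm
  | call e ih =>
    by_cases he : (e.eval ρ f σ).Total
    · exact ⟨_, mem_insert _ _, _, he, b, hb, fun h hh U hU =>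
        hh _ (e.eval_mem_daimonize ρ f hU (hθ h U hU))⟩
    · obtain ⟨b₁, hb₁⟩ := Val.exists_bad he
      obtain ⟨r, hr, w, hw, b', hb', H⟩ := ih hb₁
      exact ⟨_, mem_insert_of_mem _ (mem_image_of_mem _ hr), w, hw, b', hb',
        fun h hh U hU => Term.mem_interp_daimon₁ hU (H h hh U hU) _⟩
  | fn g e ih =>
    have he : ¬ (e.eval ρ f σ).Total := fun he => hb.not_total (hρ g _ he)
    obtain ⟨b₁, hb₁⟩ := Val.exists_bad he
    obtain ⟨r, hr, w, hw, b', hb', H⟩ := ih hb₁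
    exact ⟨_, mem_image_of_mem _ hr, w, hw, b', hb',
      fun h hh U hU => Term.mem_interp_daimon₁ hU (H h hh U hU) _⟩

/-- A total argument of the function being defined with a non-total result leads, through a summand
of the call-graph `G(T_f)`, to another one. -/
theorem RecDef.exists_call_of_bad (δ : RecDef Φ A B) {ρ : Env Φ} (hρ : ρ.Total) {v : 𝒯.Sem A}
    (hv : v.Total) {b : ℕ → SizeChange.Step S} (hb : (δ.sem ρ v).1.Bad b)
    (ρ' : Empty → Apx S → Apx S) :
    ∃ r ∈ Term.callGraphSum δ.term, ∃ w : 𝒯.Sem A, w.Total ∧ ∃ b', (δ.sem ρ w).1.Bad b' ∧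
      ∀ h : Apx S → Apx S, (∀ U, w.1 ∈ U → (δ.sem ρ w).1.restrict b' ∈ h U) →
        ∀ U, v.1 ∈ U → (δ.sem ρ v).1.restrict b ∈ r.interp ρ' h U := by
  obtain ⟨cl, hcl, hm, he⟩ := exists_clause_of_total ρ (δ.sem ρ) hv (δ.exhaustive v hv)
  rw [δ.sem_apply ρ v, he] at hb ⊢
  obtain ⟨r, hr, H⟩ := cl.rhs.exists_call_of_bad hρ (δ.sem ρ) (Pat.total_unifier hv hm)
    (θ := cl.pat.extract .x) (ρ' := ρ') (v := v.1)
    (fun h U hU y => Pat.unifier_mem_extract (t := .x) hU hm y) hb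
  exact ⟨r, mem_biUnion ⟨cl, hcl, rfl⟩ hr, H⟩

end SizeChange

theorem mainTheorem2 {S : Signature} {𝒯 : SizeChange.TypeSystem S} {Φ : SizeChange.FunSig 𝒯}
    {A B : 𝒯.Ty} (δ : SizeChange.RecDef Φ A B)
    (hpaths : ∀ s : ℕ → SizeChange.Term S Empty,
      SizeChange.Term.IsInfinitePath (SizeChange.Term.callGraphSum δ.term) s →
        SizeChange.Term.TotalPath Empty.elim s)
    (ρ : SizeChange.Env Φ) (hρ : ρ.Total) :
    SizeChange.TotalFun (δ.sem ρ) := by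
  open SizeChange in
  intro v₀ hv₀
  by_contra hnt
  obtain ⟨b₀, hb₀⟩ := Val.exists_bad hnt
  -- the states are the total arguments with a non-total result, and the next state is the argument
  -- of a recursive call responsible for the non-totality
  let State := {c : 𝒯.Sem A × (ℕ → SizeChange.Step S) // c.1.Total ∧ (δ.sem ρ c.1).1.Bad c.2}
  have hstep : ∀ c : State, ∃ (r : Term S Empty) (c' : State),
      r ∈ Term.callGraphSum δ.term ∧
      ∀ h : Apx S → Apx S,
        (∀ U, c'.1.1.1 ∈ U → (δ.sem ρ c'.1.1).1.restrict c'.1.2 ∈ h U) →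
        ∀ U, c.1.1.1 ∈ U → (δ.sem ρ c.1.1).1.restrict c.1.2 ∈ r.interp Empty.elim h U := by
    intro c
    obtain ⟨r, hr, w, hw, b', hb', H⟩ := δ.exists_call_of_bad hρ c.2.1 c.2.2 Empty.elim
    exact ⟨r, ⟨(w, b'), hw, hb'⟩, hr, H⟩
  choose r next hr H using hstep
  let c : ℕ → State := fun k => Nat.rec ⟨(v₀, b₀), hv₀, hb₀⟩ (fun _ c => next c) k
  let s : ℕ → Term S Empty := fun k => Nat.rec (.call .x) (fun k t => Term.unfoldWith (r (c k)) t) k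
  have hpath : Term.IsInfinitePath (Term.callGraphSum δ.term) s := by
    refine ⟨⟨rfl, fun k => Term.unfolds_unfoldWith (hr (c k)) (s k)⟩, fun k => ?_⟩
    induction k with
    | zero => trivial
    | succ k ih =>
      obtain ⟨t, -, ht⟩ := Set.mem_iUnion₂.1 (hr (c k))
      exact (Term.hasCall_of_mem_callGraph ht).unfoldWith ih
  have hempty : ∀ g : Empty, Monotone (Empty.elim g : Apx S → Apx S) := fun g => g.elim
  -- the interpretation of `f` is kept general, so that it can be unfolded once more
  have hinv : ∀ k (h : Apx S → Apx S), Monotone h →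
      (∀ U, (c k).1.1.1 ∈ U → (δ.sem ρ (c k).1.1).1.restrict (c k).1.2 ∈ h U) →
      ∀ U, v₀.1 ∈ U → (δ.sem ρ v₀).1.restrict b₀ ∈ (s k).interp Empty.elim h U := by
    intro k
    induction k with
    | zero => exact fun h _ hh U hU => hh U hU
    | succ k ih =>
      intro h hm hh U hU
      exact Term.interp_unfoldWith_le hempty hm (Apx.ne_zero_of_mem hU) _ _
        (ih _ (Term.interp_mono hempty hm _) (H (c k) h hh) U hU)
  refine hb₀.restrict.not_total (hpaths s hpath _ (Apx.total_single hv₀) _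
    (Set.mem_iInter.2 fun k => hinv k Apx.daimon Apx.daimon_mono (fun U hU => ?_) _
      Apx.mem_single))
  rw [Apx.daimon_of_ne_zero (Apx.ne_zero_of_mem hU)]
  exact Apx.mem_bot _
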